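/- Let $A$ be a finite dimensional quasi-Hopf algebra over $\mathbb{C}$, with coproduct $\Delta$, counit $\varepsilon$, associator $\Phi$, (bijective) antipode $S$ and distinguished elements $\alpha,\beta$, and let $I=\mathrm{Rad}(A)$ be its Jacobson radical. Suppose that $I$ is a quasi-Hopf ideal, i.e. $\Delta(I)\subseteq I\otimes A+A\otimes I$, $\varepsilon(I)=0$ and $S(I)\subseteq I$, and let $A_0=\mathrm{gr}(A)=\bigoplus_{n\ge 0}I^n/I^{n+1}$ be the associated graded quasi-Hopf algebra of $A$ with respect to the radical filtration. Suppose that $A_0$ is a Hopf algebra, i.e. that the associator of $A_0$ is equal to $1$. If $H^3(A_0^*,\mathbb{C})=0$, where $H^\bullet(A_0^*,\mathbb{C})$ is the Hochschild cohomology of the dual algebra $A_0^*$ with coefficients in the trivial $A_0^*$-bimodule $\mathbb{C}$ (on which $A_0^*$ acts through $f\mapsto f(1)$), then $A$ is twist equivalent to a Hopf algebra. Here twist equivalence means that there is an invertible $J\in A\otimes A$ with $(\varepsilon\otimes\mathrm{id})(J)=1=(\mathrm{id}\otimes\varepsilon)(J)$ such that the twisted quasi-Hopf algebra $A^J$, with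 coproduct $\Delta^J(a)=J\Delta(a)J^{-1}$, associator $\Phi^J=(1\otimes J)(\mathrm{id}\otimes\Delta)(J)\,\Phi\,(\Delta\otimes\mathrm{id})(J^{-1})(J^{-1}\otimes 1)$ and the same product, unit and counit, is isomorphic to a Hopf algebra, i.e. to a quasi-Hopf algebra with associator $1$ and $\alpha=\beta=1$; as usual, the triple $(S,\alpha,\beta)$ of a quasi-Hopf algebra is considered up to the change $(S,\alpha,\beta)\mapsto(uS(\cdot)u^{-1},u\alpha,\beta u^{-1})$ with $u$ invertible. -/

import Mathlib

open scoped TensorProduct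

universe u v

set_option maxSynthPendingDepth 5

noncomputable section

namespace QH

/-! ## Quasi-Hopf algebras -/

section Maps

variable (k : Type*) [Field k] {A : Type*} [Ring A] [Algebra k A]

/-- `id ⊗ Δ : A ⊗ A → A ⊗ A ⊗ A`. -/
def idComul (Δ : A →ₐ[k] A ⊗[k] A) : A ⊗[k] A →ₐ[k] A ⊗[k] (A ⊗[k] A) :=
  Algebra.TensorProduct.map (AlgHom.id k A) Δ

/-- `Δ ⊗ id : A ⊗ A → A ⊗ A ⊗ A`. -/
def comulId (Δ : A →ₐ[k] A ⊗[k] A) : A ⊗[k] A →ₐ[k] A ⊗[k] (A ⊗[k] A) :=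
  (Algebra.TensorProduct.assoc k k k A A A).toAlgHom.comp
    (Algebra.TensorProduct.map Δ (AlgHom.id k A))

/-- `id ⊗ id ⊗ Δ`. -/
def idIdComul (Δ : A →ₐ[k] A ⊗[k] A) :
    A ⊗[k] (A ⊗[k] A) →ₐ[k] A ⊗[k] (A ⊗[k] (A ⊗[k] A)) :=
  Algebra.TensorProduct.map (AlgHom.id k A) (idComul k Δ)

/-- `id ⊗ Δ ⊗ id`. -/
def idComulId (Δ : A →ₐ[k] A ⊗[k] A) :
    A ⊗[k] (A ⊗[k] A) →ₐ[k] A ⊗[k] (A ⊗[k] (A ⊗[k] A)) :=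
  Algebra.TensorProduct.map (AlgHom.id k A) (comulId k Δ)

/-- `Δ ⊗ id ⊗ id`. -/
def comulIdId (Δ : A →ₐ[k] A ⊗[k] A) :
    A ⊗[k] (A ⊗[k] A) →ₐ[k] A ⊗[k] (A ⊗[k] (A ⊗[k] A)) :=
  (Algebra.TensorProduct.assoc k k k A A (A ⊗[k] A)).toAlgHom.comp
    (Algebra.TensorProduct.map Δ (AlgHom.id k (A ⊗[k] A)))

variable (A)

/-- `t ↦ 1 ⊗ t` on `A ⊗ A`. -/
def oneTensor₂ : A ⊗[k] A →ₐ[k] A ⊗[k] (A ⊗[k] A) := Algebra.TensorProduct.includeRight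

/-- `t ↦ t ⊗ 1` on `A ⊗ A`. -/
def tensorOne₂ : A ⊗[k] A →ₐ[k] A ⊗[k] (A ⊗[k] A) :=
  Algebra.TensorProduct.map (AlgHom.id k A) Algebra.TensorProduct.includeLeft

/-- `t ↦ 1 ⊗ t` on `A ⊗ A ⊗ A`. -/
def oneTensor₃ : A ⊗[k] (A ⊗[k] A) →ₐ[k] A ⊗[k] (A ⊗[k] (A ⊗[k] A)) :=
  Algebra.TensorProduct.includeRight

/-- `t ↦ t ⊗ 1` on `A ⊗ A ⊗ A`. -/
def tensorOne₃ : A ⊗[k] (A ⊗[k] A) →ₐ[k] A ⊗[k] (A ⊗[k] (A ⊗[k] A)) :=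
  Algebra.TensorProduct.map (AlgHom.id k A) (tensorOne₂ k A)

variable {A}

/-- `ε ⊗ id : A ⊗ A → A`. -/
def counitId (ε : A →ₐ[k] k) : A ⊗[k] A →ₐ[k] A :=
  (Algebra.TensorProduct.lid k A).toAlgHom.comp (Algebra.TensorProduct.map ε (AlgHom.id k A))

/-- `id ⊗ ε : A ⊗ A → A`. -/
def idCounit (ε : A →ₐ[k] k) : A ⊗[k] A →ₐ[k] A :=
  (Algebra.TensorProduct.rid k k A).toAlgHom.comp (Algebra.TensorProduct.map (AlgHom.id k A) ε)

/-- `id ⊗ ε ⊗ id : A ⊗ A ⊗ A → A ⊗ A`. -/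
def idCounitId (ε : A →ₐ[k] k) : A ⊗[k] (A ⊗[k] A) →ₐ[k] A ⊗[k] A :=
  Algebra.TensorProduct.map (AlgHom.id k A) (counitId k ε)

/-- `x ⊗ y ↦ S(x) a y`. -/
def sandL (S : A →ₗ[k] A) (a : A) : A ⊗[k] A →ₗ[k] A :=
  LinearMap.mul' k A ∘ₗ TensorProduct.map (LinearMap.mulRight k a ∘ₗ S) LinearMap.id

/-- `x ⊗ y ↦ x b S(y)`. -/
def sandR (S : A →ₗ[k] A) (b : A) : A ⊗[k] A →ₗ[k] A :=
  LinearMap.mul' k A ∘ₗ TensorProduct.map (LinearMap.mulRight k b) S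

/-- `x ⊗ y ⊗ z ↦ x b S(y) a z`. -/
def zigzagR (S : A →ₗ[k] A) (a b : A) : A ⊗[k] (A ⊗[k] A) →ₗ[k] A :=
  LinearMap.mul' k A ∘ₗ TensorProduct.map (LinearMap.mulRight k b) (sandL k S a)

/-- `x ⊗ y ⊗ z ↦ S(x) a y b S(z)`. -/
def zigzagL (S : A →ₗ[k] A) (a b : A) : A ⊗[k] (A ⊗[k] A) →ₗ[k] A :=
  LinearMap.mul' k A ∘ₗ TensorProduct.map (LinearMap.mulRight k a ∘ₗ S) (sandR k S b)

end Maps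

/-- A quasi-Hopf algebra structure `(Δ, ε, Φ, S, α, β)` on an associative unital algebra `A`. -/
structure QuasiHopf (k : Type u) (A : Type v) [Field k] [Ring A] [Algebra k A] where
  /-- The coproduct `Δ`. -/
  comul : A →ₐ[k] A ⊗[k] A
  /-- The counit `ε`. -/
  counit : A →ₐ[k] k
  /-- The associator `Φ`. -/
  assoc : (A ⊗[k] (A ⊗[k] A))ˣ
  /-- The antipode `S`. -/
  antipode : A →ₗ[k] A
  /-- The distinguished element `α`. -/
  alpha : A
  /-- The distinguished element `β`. -/
  beta : A
  /-- `(id ⊗ Δ)(Δ(a)) = Φ (Δ ⊗ id)(Δ(a)) Φ⁻¹` -/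
  quasi_coassoc : ∀ a : A, idComul k comul (comul a) =
    (assoc : A ⊗[k] (A ⊗[k] A)) * comulId k comul (comul a) *
      (↑assoc⁻¹ : A ⊗[k] (A ⊗[k] A))
  /-- `(id ⊗ id ⊗ Δ)(Φ) (Δ ⊗ id ⊗ id)(Φ) = (1 ⊗ Φ) (id ⊗ Δ ⊗ id)(Φ) (Φ ⊗ 1)` -/
  pentagon : idIdComul k comul (assoc : A ⊗[k] (A ⊗[k] A)) *
      comulIdId k comul (assoc : A ⊗[k] (A ⊗[k] A)) =
    oneTensor₃ k A (assoc : A ⊗[k] (A ⊗[k] A)) *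
      idComulId k comul (assoc : A ⊗[k] (A ⊗[k] A)) *
      tensorOne₃ k A (assoc : A ⊗[k] (A ⊗[k] A))
  counit_comul : ∀ a : A, counitId k counit (comul a) = a
  comul_counit : ∀ a : A, idCounit k counit (comul a) = a
  /-- `(id ⊗ ε ⊗ id)(Φ) = 1` -/
  counit_assoc : idCounitId k counit (assoc : A ⊗[k] (A ⊗[k] A)) = 1
  antipode_one : antipode 1 = 1
  antipode_mul : ∀ a b : A, antipode (a * b) = antipode b * antipode a
  antipode_bijective : Function.Bijective antipode
  /-- `∑ S(a₁) α a₂ = ε(a) α` -/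
  antipode_left : ∀ a : A, sandL k antipode alpha (comul a) = counit a • alpha
  /-- `∑ a₁ β S(a₂) = ε(a) β` -/
  antipode_right : ∀ a : A, sandR k antipode beta (comul a) = counit a • beta
  /-- `∑ X β S(Y) α Z = 1` for `Φ = ∑ X ⊗ Y ⊗ Z` -/
  zigzag_assoc : zigzagR k antipode alpha beta (assoc : A ⊗[k] (A ⊗[k] A)) = 1
  /-- `∑ S(P) α Q β S(R) = 1` for `Φ⁻¹ = ∑ P ⊗ Q ⊗ R` -/
  zigzag_assoc_inv : zigzagL k antipode alpha beta (↑assoc⁻¹ : A ⊗[k] (A ⊗[k] A)) = 1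

namespace QuasiHopf

variable {k : Type*} [Field k] {A : Type*} [Ring A] [Algebra k A]

/-! ### Twists -/

/-- A twist: an invertible `J ∈ A ⊗ A` with `(ε ⊗ id)(J) = 1 = (id ⊗ ε)(J)`. -/
def IsTwist (Q : QuasiHopf k A) (J : (A ⊗[k] A)ˣ) : Prop :=
  counitId k Q.counit (J : A ⊗[k] A) = 1 ∧ idCounit k Q.counit (J : A ⊗[k] A) = 1

/-- The twisted coproduct `a ↦ J Δ(a) J⁻¹`. -/
def twistComul (Q : QuasiHopf k A) (J : (A ⊗[k] A)ˣ) (a : A) : A ⊗[k] A :=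
  (J : A ⊗[k] A) * Q.comul a * (↑J⁻¹ : A ⊗[k] A)

/-- The twisted associator `(1 ⊗ J) (id ⊗ Δ)(J) Φ (Δ ⊗ id)(J⁻¹) (J⁻¹ ⊗ 1)`. -/
def twistAssoc (Q : QuasiHopf k A) (J : (A ⊗[k] A)ˣ) : A ⊗[k] (A ⊗[k] A) :=
  oneTensor₂ k A (J : A ⊗[k] A) * idComul k Q.comul (J : A ⊗[k] A) *
    (Q.assoc : A ⊗[k] (A ⊗[k] A)) *
    comulId k Q.comul (↑J⁻¹ : A ⊗[k] A) * tensorOne₂ k A (↑J⁻¹ : A ⊗[k] A)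

/-- The twisted `α`: `∑ S(d) α e` where `J⁻¹ = ∑ d ⊗ e`. -/
def twistAlpha (Q : QuasiHopf k A) (J : (A ⊗[k] A)ˣ) : A :=
  sandL k Q.antipode Q.alpha (↑J⁻¹ : A ⊗[k] A)

/-- The twisted `β`: `∑ f β S(g)` where `J = ∑ f ⊗ g`. -/
def twistBeta (Q : QuasiHopf k A) (J : (A ⊗[k] A)ˣ) : A :=
  sandR k Q.antipode Q.beta (J : A ⊗[k] A)

/-- `Q` and `R` are twist equivalent: there are a twist `J` of `Q` and an algebra isomorphism `f`
which is an isomorphism of quasi-Hopf algebras from the twist of `Q` by `J` onto `R`. As usual,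
the triple `(S, α, β)` of a quasi-Hopf algebra only matters up to the change
`(S, α, β) ↦ (u S(·) u⁻¹, u α, β u⁻¹)` with `u` invertible. -/
def TwistEquivalent {B : Type*} [Ring B] [Algebra k B]
    (Q : QuasiHopf k A) (R : QuasiHopf k B) : Prop :=
  ∃ (J : (A ⊗[k] A)ˣ) (f : A ≃ₐ[k] B) (u : Aˣ),
    Q.IsTwist J ∧
    (∀ a, R.comul (f a) =
      Algebra.TensorProduct.map f.toAlgHom f.toAlgHom (Q.twistComul J a)) ∧
    (∀ a, R.counit (f a) = Q.counit a) ∧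
    (R.assoc : B ⊗[k] (B ⊗[k] B)) =
      Algebra.TensorProduct.map f.toAlgHom
        (Algebra.TensorProduct.map f.toAlgHom f.toAlgHom) (Q.twistAssoc J) ∧
    (∀ a, R.antipode (f a) = f (u * Q.antipode a * ↑u⁻¹)) ∧
    R.alpha = f (u * Q.twistAlpha J) ∧
    R.beta = f (Q.twistBeta J * ↑u⁻¹)

/-! ### Hopf algebras as quasi-Hopf algebras -/

/-- A Hopf algebra with bijective antipode, as a quasi-Hopf algebra with `Φ = 1`,
`α = β = 1`. -/
def ofHopf (k : Type*) [Field k] (H : Type*) [Ring H] [HopfAlgebra k H]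
    (hS : Function.Bijective (HopfAlgebra.antipode k (A := H))) : QuasiHopf k H where
  comul := Bialgebra.comulAlgHom k H
  counit := Bialgebra.counitAlgHom k H
  assoc := 1
  antipode := HopfAlgebra.antipode k
  alpha := 1
  beta := 1
  quasi_coassoc a := by
    rw [Units.val_one, inv_one, Units.val_one, one_mul, mul_one]
    exact (Coalgebra.coassoc_apply (R := k) a).symm
  pentagon := by
    rw [Units.val_one]
    simp only [map_one, mul_one]
  counit_comul a := by
    have := congrArg (TensorProduct.lid k H) (Coalgebra.rTensor_counit_comul (R := k) a)
    exact this.trans (by simp)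
  comul_counit a := by
    have := congrArg (TensorProduct.rid k H) (Coalgebra.lTensor_counit_comul (R := k) a)
    exact this.trans (by simp)
  counit_assoc := by simp only [Units.val_one, map_one]
  antipode_one := HopfAlgebra.antipode_one
  antipode_mul := HopfAlgebra.antipode_mul_antidistrib
  antipode_bijective := hS
  antipode_left a := by
    have := HopfAlgebra.mul_antipode_rTensor_comul_apply (R := k) a
    rw [Algebra.algebraMap_eq_smul_one] at this
    simp only [sandL, LinearMap.mulRight_one, LinearMap.id_comp]
    exact this
  antipode_right a := by
    have := HopfAlgebra.mul_antipode_lTensor_comul_apply (R := k) a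
    rw [Algebra.algebraMap_eq_smul_one] at this
    simp only [sandR, LinearMap.mulRight_one]
    exact this
  zigzag_assoc := by
    simp [zigzagR, sandL, Algebra.TensorProduct.one_def]
  zigzag_assoc_inv := by
    simp [zigzagL, sandR, Algebra.TensorProduct.one_def]

/-- A quasi-Hopf algebra is a Hopf algebra if its associator is `1`. -/
def IsHopf (Q : QuasiHopf k A) : Prop := Q.assoc = 1

lemma beta_mul_alpha (Q : QuasiHopf k A) (h : Q.IsHopf) : Q.beta * Q.alpha = 1 := by
  have h1 := Q.zigzag_assoc
  rw [show Q.assoc = 1 from h] at h1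
  simpa [zigzagR, sandL, Algebra.TensorProduct.one_def, Q.antipode_one] using h1

/-- The bialgebra underlying a quasi-Hopf algebra whose associator is `1`. -/
@[reducible] def toBialgebra (Q : QuasiHopf k A) (h : Q.IsHopf) : Bialgebra k A :=
  Bialgebra.ofAlgHom Q.comul Q.counit
    (by
      ext a
      have h1 := Q.quasi_coassoc a
      rw [show Q.assoc = 1 from h] at h1
      rw [Units.val_one, inv_one, Units.val_one, one_mul, mul_one] at h1
      exact h1.symm)
    (by
      ext a
      have h1 := Q.counit_comul a
      exact (Algebra.TensorProduct.lid k A).injective (by simpa [counitId] using h1))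
    (by
      ext a
      have h1 := Q.comul_counit a
      exact (Algebra.TensorProduct.rid k k A).injective (by simpa [idCounit] using h1))

/-- The Hopf algebra underlying a quasi-Hopf algebra whose associator is `1`; its antipode is
`a ↦ β S(a) α`, where `α = β⁻¹`. -/
@[reducible] def toHopfAlgebra (Q : QuasiHopf k A) (h : Q.IsHopf) : HopfAlgebra k A :=
  { Q.toBialgebra h with
    antipode := LinearMap.mulLeft k Q.beta ∘ₗ LinearMap.mulRight k Q.alpha ∘ₗ Q.antipode
    mul_antipode_rTensor_comul := by
      ext a
      have h1 := congrArg (Q.beta * ·) (Q.antipode_left a)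
      simp only [mul_smul_comm, Q.beta_mul_alpha h, ← Algebra.algebraMap_eq_smul_one] at h1
      refine Eq.trans ?_ h1
      change _ = (LinearMap.mulLeft k Q.beta ∘ₗ sandL k Q.antipode Q.alpha) (Q.comul a)
      change (LinearMap.mul' k A ∘ₗ LinearMap.rTensor A _) (Q.comul a) = _
      congr 1
      ext x y
      simp [sandL, mul_assoc]
    mul_antipode_lTensor_comul := by
      ext a
      have h1 := congrArg (· * Q.alpha) (Q.antipode_right a)
      simp only [smul_mul_assoc, Q.beta_mul_alpha h, ← Algebra.algebraMap_eq_smul_one] at h1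
      refine Eq.trans ?_ h1
      change _ = (LinearMap.mulRight k Q.alpha ∘ₗ sandR k Q.antipode Q.beta) (Q.comul a)
      change (LinearMap.mul' k A ∘ₗ LinearMap.lTensor A _) (Q.comul a) = _
      congr 1
      ext x y
      simp [sandR, mul_assoc] }

end QuasiHopf

/-! ## The third Hochschild cohomology with trivial coefficients -/

section Hochschild

variable {k : Type*} [Field k] {B : Type*} [Ring B] [Algebra k B]

/-- Hochschild 3-cocycles of the augmented algebra `(B, ε)` with values in the trivial
`B`-bimodule `k`. -/
def Z3 (ε : B →ₐ[k] k) : Submodule k (B →ₗ[k] B →ₗ[k] B →ₗ[k] k) where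
  carrier := {f | ∀ a b c d : B,
    ε a * f b c d - f (a * b) c d + f a (b * c) d - f a b (c * d) + f a b c * ε d = 0}
  zero_mem' := by intro a b c d; simp
  add_mem' := by
    intro f g hf hg a b c d
    have h := congrArg₂ (· + ·) (hf a b c d) (hg a b c d)
    simp only [LinearMap.add_apply, add_zero] at h ⊢
    linear_combination h
  smul_mem' := by
    intro r f hf a b c d
    simp only [LinearMap.smul_apply, smul_eq_mul]
    linear_combination r * hf a b c d

/-- Hochschild 3-coboundaries of the augmented algebra `(B, ε)` with values in the trivial
`B`-bimodule `k`. -/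
def B3 (ε : B →ₐ[k] k) : Submodule k (B →ₗ[k] B →ₗ[k] B →ₗ[k] k) where
  carrier := {f | ∃ j : B →ₗ[k] B →ₗ[k] k, ∀ a b c : B,
    f a b c = ε a * j b c - j (a * b) c + j a (b * c) - j a b * ε c}
  zero_mem' := ⟨0, by intro a b c; simp⟩
  add_mem' := by
    rintro f g ⟨i, hi⟩ ⟨j, hj⟩
    refine ⟨i + j, fun a b c => ?_⟩
    simp only [LinearMap.add_apply, hi, hj]
    ring
  smul_mem' := by
    rintro r f ⟨i, hi⟩
    refine ⟨r • i, fun a b c => ?_⟩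
    simp only [LinearMap.smul_apply, hi, smul_eq_mul]
    ring

lemma B3_le_Z3 (ε : B →ₐ[k] k) : B3 ε ≤ Z3 ε := by
  rintro f ⟨j, hj⟩ a b c d
  simp only [hj, map_mul, mul_assoc]
  ring

/-- `H³(B, k) = Z³(B, k) / B³(B, k)`. -/
abbrev H3 (ε : B →ₐ[k] k) : Type _ := Z3 ε ⧸ (B3 ε).submoduleOf (Z3 ε)

lemma subsingleton_H3_iff (ε : B →ₐ[k] k) : Subsingleton (H3 ε) ↔ Z3 ε ≤ B3 ε := by
  rw [Submodule.Quotient.subsingleton_iff, Submodule.submoduleOf,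
    Submodule.comap_subtype_eq_top]

end Hochschild

/-- The augmentation `f ↦ f(1)` of the dual algebra `H*` of a bialgebra `H` (the space of linear
forms on `H` with the convolution product); it is the counit of `H*` if `H` is finite
dimensional. -/
def dualAug (k : Type*) [Field k] (H : Type*) [Ring H] [Bialgebra k H] :
    WithConv (H →ₗ[k] k) →ₐ[k] k :=
  AlgHom.ofLinearMap
    { toFun := fun f => f.ofConv 1
      map_add' := by intro f g; rw [WithConv.ofConv_add, LinearMap.add_apply]
      map_smul' := by intro r f; rw [WithConv.ofConv_smul, LinearMap.smul_apply]; rfl }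
    (by
      change (1 : WithConv (H →ₗ[k] k)).ofConv 1 = 1
      simp)
    (by
      intro f g
      change (f * g).ofConv 1 = f.ofConv 1 * g.ofConv 1
      simp [LinearMap.convMul_apply, Algebra.TensorProduct.one_def])

/-- `H³(H*, k)` for a Hopf algebra `H`, given as a quasi-Hopf algebra with associator `1`. -/
abbrev QuasiHopf.DualH3 {k : Type*} [Field k] {A : Type*} [Ring A] [Algebra k A]
    (Q : QuasiHopf k A) (h : Q.IsHopf) : Type _ :=
  letI := Q.toHopfAlgebra h
  H3 (dualAug k A)

/-! ## Filtered vector spaces and leading terms -/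

section Filtrations

variable {k : Type*} [Field k]

/-- A descending filtration of a vector space `V`, with maps `sym n : V → G` which kill
`fil (n + 1)`. Only the values of `sym n` on `fil n` matter: there `sym n` is to be read as the map
`fil n → fil n / fil (n + 1) → G` that takes an element to its leading term of degree `n`; it is
extended to all of `V` for convenience. -/
structure Filt (k V G : Type*) [Field k] [AddCommGroup V] [Module k V] [AddCommGroup G]
    [Module k G] where
  fil : ℕ → Submodule k V
  sym : ℕ → V →ₗ[k] G
  fil_succ_le : ∀ n, fil (n + 1) ≤ fil n
  sym_succ : ∀ n, ∀ x ∈ fil (n + 1), sym n x = 0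

namespace Filt

variable {V W U G G' G'' : Type*} [AddCommGroup V] [Module k V] [AddCommGroup W] [Module k W]
  [AddCommGroup U] [Module k U] [AddCommGroup G] [Module k G] [AddCommGroup G'] [Module k G']
  [AddCommGroup G''] [Module k G'']

lemma anti (P : Filt k V G) {m n : ℕ} (h : m ≤ n) : P.fil n ≤ P.fil m :=
  antitone_nat_of_succ_le P.fil_succ_le h

lemma sym_eq_zero (P : Filt k V G) {m n : ℕ} (h : m < n) {x : V} (hx : x ∈ P.fil n) :
    P.sym m x = 0 :=
  P.sym_succ m x (P.anti h hx)

/-- The value of `∑_{i + j = n} sym i ⊗ sym j` on a product of elements of `fil i` and `fil j`. -/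
lemma sum_sym_tmul (P : Filt k V G) (P' : Filt k W G') {i j n : ℕ} (h : n ≤ i + j)
    {x : V} (hx : x ∈ P.fil i) {y : W} (hy : y ∈ P'.fil j) :
    (∑ p ∈ Finset.HasAntidiagonal.antidiagonal n, TensorProduct.map (P.sym p.1) (P'.sym p.2)) (x ⊗ₜ[k] y) =
      if n = i + j then P.sym i x ⊗ₜ[k] P'.sym j y else 0 := by
  rw [LinearMap.sum_apply]
  have key : ∀ p ∈ Finset.HasAntidiagonal.antidiagonal n, p ≠ (i, j) →
      TensorProduct.map (P.sym p.1) (P'.sym p.2) (x ⊗ₜ[k] y) = 0 := by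
    rintro ⟨a, b⟩ hp hne
    rw [Finset.HasAntidiagonal.mem_antidiagonal] at hp
    simp only at hp
    rw [TensorProduct.map_tmul]
    rcases lt_or_ge a i with ha | ha
    · rw [P.sym_eq_zero ha hx, TensorProduct.zero_tmul]
    · have hb : b < j := by
        rcases lt_or_ge b j with hb | hb
        · exact hb
        · exact absurd (Prod.ext (by simp; omega) (by simp; omega)) hne
      rw [P'.sym_eq_zero hb hy, TensorProduct.tmul_zero]
  split_ifs with hn
  · rw [Finset.sum_eq_single (i, j) key]
    · rfl
    · intro hm
      exact absurd (Finset.HasAntidiagonal.mem_antidiagonal.2 hn.symm) hm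
  · refine Finset.sum_eq_zero fun p hp => key p hp ?_
    rintro rfl
    exact hn (Finset.HasAntidiagonal.mem_antidiagonal.1 hp).symm

/-- The tensor product of filtrations, `fil n = ∑_{i + j = n} fil i ⊗ fil j`; the leading term of
`x ⊗ y` for `x ∈ fil i`, `y ∈ fil j` is the tensor product of the leading terms. -/
def tensor (P : Filt k V G) (P' : Filt k W G') : Filt k (V ⊗[k] W) (G ⊗[k] G') where
  fil n := Submodule.span k
    {t | ∃ i j, i + j = n ∧ ∃ x ∈ P.fil i, ∃ y ∈ P'.fil j, t = x ⊗ₜ[k] y}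
  sym n := ∑ p ∈ Finset.HasAntidiagonal.antidiagonal n, TensorProduct.map (P.sym p.1) (P'.sym p.2)
  fil_succ_le n := by
    rw [Submodule.span_le]
    rintro _ ⟨i, j, hij, x, hx, y, hy, rfl⟩
    apply Submodule.subset_span
    rcases i with _ | i
    · exact ⟨0, n, by omega, x, hx, y, P'.anti (by omega) hy, rfl⟩
    · exact ⟨i, j, by omega, x, P.anti (by omega) hx, y, hy, rfl⟩
  sym_succ n x hx := by
    induction hx using Submodule.span_induction with
    | mem t ht =>
      obtain ⟨i, j, hij, x, hx, y, hy, rfl⟩ := ht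
      rw [sum_sym_tmul P P' (by omega) hx hy, if_neg (by omega)]
    | zero => exact map_zero _
    | add a b _ _ ha hb => rw [map_add, ha, hb, add_zero]
    | smul c a _ ha => rw [map_smul, ha, smul_zero]

lemma tmul_mem (P : Filt k V G) (P' : Filt k W G') {i j n : ℕ} (h : n = i + j)
    {x : V} (hx : x ∈ P.fil i) {y : W} (hy : y ∈ P'.fil j) :
    x ⊗ₜ[k] y ∈ (P.tensor P').fil n :=
  Submodule.subset_span ⟨i, j, h.symm, x, hx, y, hy, rfl⟩

lemma sym_tmul (P : Filt k V G) (P' : Filt k W G') {i j n : ℕ} (h : n = i + j)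
    {x : V} (hx : x ∈ P.fil i) {y : W} (hy : y ∈ P'.fil j) :
    (P.tensor P').sym n (x ⊗ₜ[k] y) = P.sym i x ⊗ₜ[k] P'.sym j y :=
  (sum_sym_tmul P P' h.le hx hy).trans (if_pos h)

lemma tensor_top {P : Filt k V G} {P' : Filt k W G'} (h : P.fil 0 = ⊤) (h' : P'.fil 0 = ⊤) :
    (P.tensor P').fil 0 = ⊤ := by
  refine Submodule.eq_top_iff'.2 fun t => ?_
  induction t with
  | zero => exact zero_mem _
  | add a b ha hb => exact add_mem ha hb
  | tmul x y =>
    exact tmul_mem P P' (i := 0) (j := 0) rfl (h ▸ Submodule.mem_top) (h' ▸ Submodule.mem_top)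

variable (k) in
/-- The ground field, concentrated in degree `0`. -/
def unit : Filt k k k where
  fil n := if n = 0 then ⊤ else ⊥
  sym n := if n = 0 then LinearMap.id else 0
  fil_succ_le n := by simp
  sym_succ n x hx := by
    simp only [Nat.add_eq_zero_iff, one_ne_zero, and_false, if_false, Submodule.mem_bot] at hx
    rw [hx, map_zero]

/-- `f` raises the filtration degree by at least `d`, and `f₀` is its leading part of
degree `d`. -/
def Compat (P : Filt k V G) (P' : Filt k W G') (d : ℕ) (f : V → W) (f₀ : G → G') : Prop :=
  ∀ n m, m = n + d → ∀ x ∈ P.fil n, f x ∈ P'.fil m ∧ f₀ (P.sym n x) = P'.sym m (f x)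

lemma Compat.comp {P : Filt k V G} {P' : Filt k W G'} {P'' : Filt k U G''} {d e : ℕ}
    {g : W → U} {g₀ : G' → G''} {f : V → W} {f₀ : G → G'}
    (hg : Compat P' P'' e g g₀) (hf : Compat P P' d f f₀) :
    Compat P P'' (d + e) (g ∘ f) (g₀ ∘ f₀) := by
  intro n m hm x hx
  obtain ⟨h1, h2⟩ := hf n _ rfl x hx
  obtain ⟨h3, h4⟩ := hg (n + d) m (by omega) _ h1
  exact ⟨h3, by rw [Function.comp_apply, h2, h4, Function.comp_apply]⟩

lemma Compat.id (P : Filt k V G) : Compat P P 0 (fun x => x) (fun x => x) := by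
  rintro n m rfl x hx
  exact ⟨hx, rfl⟩

lemma Compat.of_tmul {P : Filt k V G} {P' : Filt k W G'} {P'' : Filt k U G''} {d : ℕ}
    (F : V ⊗[k] W →ₗ[k] U) (F₀ : G ⊗[k] G' →ₗ[k] G'')
    (h : ∀ i j m, m = i + j + d → ∀ x ∈ P.fil i, ∀ y ∈ P'.fil j,
      F (x ⊗ₜ y) ∈ P''.fil m ∧ F₀ (P.sym i x ⊗ₜ P'.sym j y) = P''.sym m (F (x ⊗ₜ y))) :
    Compat (P.tensor P') P'' d F F₀ := by
  intro n m hm t ht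
  induction ht using Submodule.span_induction with
  | mem t ht =>
    obtain ⟨i, j, hij, x, hx, y, hy, rfl⟩ := ht
    obtain ⟨h1, h2⟩ := h i j m (by omega) x hx y hy
    exact ⟨h1, by rw [sym_tmul P P' hij.symm hx hy, h2]⟩
  | zero => simp
  | add a b _ _ ha hb =>
    simp only [map_add]
    exact ⟨add_mem ha.1 hb.1, by rw [ha.2, hb.2]⟩
  | smul c a _ ha =>
    simp only [map_smul]
    exact ⟨Submodule.smul_mem _ _ ha.1, by rw [ha.2]⟩

lemma Compat.map {V' W' H H' : Type*} [AddCommGroup V'] [Module k V'] [AddCommGroup W']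
    [Module k W'] [AddCommGroup H] [Module k H] [AddCommGroup H'] [Module k H']
    {P : Filt k V G} {P' : Filt k W G'} {R : Filt k V' H} {R' : Filt k W' H'}
    {f : V →ₗ[k] W} {f₀ : G →ₗ[k] G'} {g : V' →ₗ[k] W'} {g₀ : H →ₗ[k] H'}
    (hf : Compat P P' 0 f f₀) (hg : Compat R R' 0 g g₀) :
    Compat (P.tensor R) (P'.tensor R') 0 (TensorProduct.map f g) (TensorProduct.map f₀ g₀) := by
  refine Compat.of_tmul _ _ ?_
  rintro i j m rfl x hx y hy
  obtain ⟨h1, h2⟩ := hf i i rfl x hx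
  obtain ⟨h3, h4⟩ := hg j j rfl y hy
  rw [TensorProduct.map_tmul, TensorProduct.map_tmul, h2, h4]
  exact ⟨tmul_mem _ _ rfl h1 h3, (sym_tmul _ _ rfl h1 h3).symm⟩

lemma Compat.assoc (P : Filt k V G) (P' : Filt k W G') (P'' : Filt k U G'') :
    Compat ((P.tensor P').tensor P'') (P.tensor (P'.tensor P'')) 0
      (TensorProduct.assoc k V W U) (TensorProduct.assoc k G G' G'') := by
  refine Compat.of_tmul (TensorProduct.assoc k V W U).toLinearMap
    (TensorProduct.assoc k G G' G'').toLinearMap ?_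
  rintro i j m rfl u hu z hz
  have := Compat.of_tmul (P := P) (P' := P') (P'' := P.tensor (P'.tensor P'')) (d := j)
    ((TensorProduct.assoc k V W U).toLinearMap ∘ₗ (TensorProduct.mk k (V ⊗[k] W) U).flip z)
    ((TensorProduct.assoc k G G' G'').toLinearMap ∘ₗ
      (TensorProduct.mk k (G ⊗[k] G') G'').flip (P''.sym j z)) ?_
  · exact this i _ rfl u hu
  · rintro a b m rfl x hx y hy
    have h1 := tmul_mem P' P'' rfl hy hz
    simp only [LinearMap.comp_apply, LinearMap.flip_apply, TensorProduct.mk_apply,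
      LinearEquiv.coe_coe, TensorProduct.assoc_tmul]
    refine ⟨tmul_mem P _ (by omega) hx h1, ?_⟩
    rw [sym_tmul P _ (by omega) hx h1, sym_tmul P' P'' rfl hy hz]

lemma Compat.lid (P : Filt k V G) :
    Compat ((unit k).tensor P) P 0 (TensorProduct.lid k V) (TensorProduct.lid k G) := by
  refine Compat.of_tmul (TensorProduct.lid k V).toLinearMap
    (TensorProduct.lid k G).toLinearMap ?_
  rintro i j m rfl x hx y hy
  rcases i with _ | i
  · have e : 0 + j + 0 = j := by omega
    simp only [e, LinearEquiv.coe_coe, TensorProduct.lid_tmul, map_smul]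
    exact ⟨Submodule.smul_mem _ _ hy, by simp [unit]⟩
  · obtain rfl : x = 0 := by simpa [unit] using hx
    simp

lemma Compat.rid (P : Filt k V G) :
    Compat (P.tensor (unit k)) P 0 (TensorProduct.rid k V) (TensorProduct.rid k G) := by
  refine Compat.of_tmul (TensorProduct.rid k V).toLinearMap
    (TensorProduct.rid k G).toLinearMap ?_
  rintro i j m rfl x hx y hy
  rcases j with _ | j
  · simp only [add_zero, LinearEquiv.coe_coe, TensorProduct.rid_tmul, map_smul]
    exact ⟨Submodule.smul_mem _ _ hx, by simp [unit]⟩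
  · obtain rfl : y = 0 := by simpa [unit] using hy
    simp

/-- A multiplicative filtration of an algebra: products of leading terms are leading terms of
products. -/
structure IsMult {A B : Type*} [Ring A] [Algebra k A] [Ring B] [Algebra k B]
    (P : Filt k A B) : Prop where
  top : P.fil 0 = ⊤
  one : P.sym 0 1 = 1
  mul : ∀ m n l, l = m + n → ∀ x ∈ P.fil m, ∀ y ∈ P.fil n,
    x * y ∈ P.fil l ∧ P.sym l (x * y) = P.sym m x * P.sym n y

section

variable {A B A' B' : Type*} [Ring A] [Algebra k A] [Ring B] [Algebra k B]
  [Ring A'] [Algebra k A'] [Ring B'] [Algebra k B']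

lemma IsMult.mem {P : Filt k A B} (h : P.IsMult) (x : A) : x ∈ P.fil 0 := by
  rw [h.top]; trivial

lemma IsMult.mul_tmul {P : Filt k A B} {P' : Filt k A' B'} (h : P.IsMult) (h' : P'.IsMult)
    {i j : ℕ} {x : A} (hx : x ∈ P.fil i) {y : A'} (hy : y ∈ P'.fil j) :
    Compat (P.tensor P') (P.tensor P') (i + j)
      (LinearMap.mulLeft k (x ⊗ₜ[k] y)) (LinearMap.mulLeft k (P.sym i x ⊗ₜ[k] P'.sym j y)) := by
  refine Compat.of_tmul _ _ ?_
  intro a b l hl x' hx' y' hy'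
  obtain ⟨h1, h2⟩ := h.mul i a _ rfl x hx x' hx'
  obtain ⟨h3, h4⟩ := h'.mul j b _ rfl y hy y' hy'
  rw [LinearMap.mulLeft_apply, LinearMap.mulLeft_apply, Algebra.TensorProduct.tmul_mul_tmul,
    Algebra.TensorProduct.tmul_mul_tmul, ← h2, ← h4]
  exact ⟨tmul_mem _ _ (by omega) h1 h3, (sym_tmul _ _ (by omega) h1 h3).symm⟩

lemma IsMult.mul_tensor {P : Filt k A B} {P' : Filt k A' B'} (h : P.IsMult) (h' : P'.IsMult)
    {n : ℕ} {w : A ⊗[k] A'} (hw : w ∈ (P.tensor P').fil n) :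
    Compat (P.tensor P') (P.tensor P') n
      (LinearMap.mulRight k w) (LinearMap.mulRight k ((P.tensor P').sym n w)) := by
  refine Compat.of_tmul _ _ ?_
  intro i j l hl x hx y hy
  have := h.mul_tmul h' hx hy n l (by omega) w hw
  rw [LinearMap.mulLeft_apply, LinearMap.mulLeft_apply] at this
  rw [LinearMap.mulRight_apply, LinearMap.mulRight_apply]
  exact this

lemma IsMult.tensor {P : Filt k A B} {P' : Filt k A' B'} (h : P.IsMult) (h' : P'.IsMult) :
    (P.tensor P').IsMult := by
  refine ⟨?_, ?_, ?_⟩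
  · exact tensor_top h.top h'.top
  · have := sym_tmul P P' (n := 0) rfl (h.mem 1) (h'.mem 1)
    rw [h.one, h'.one, ← Algebra.TensorProduct.one_def, ← Algebra.TensorProduct.one_def] at this
    exact this
  · intro m n l hl u hu w hw
    have := h.mul_tensor h' hw m l hl u hu
    rw [LinearMap.mulRight_apply, LinearMap.mulRight_apply] at this
    exact ⟨this.1, this.2.symm⟩

/-- Elements have leading terms of degree `0`, compatibly with products. -/
def IsMult.sym₀ {P : Filt k A B} (h : P.IsMult) : A →* B where
  toFun := P.sym 0
  map_one' := h.one
  map_mul' x y := (h.mul 0 0 0 rfl x (h.mem x) y (h.mem y)).2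

end

end Filt

end Filtrations

/-! ## The associated graded algebra -/

section Graded

variable (k : Type*) [Field k] {A : Type*} [Ring A] [Algebra k A]

/-- The subspace `Iⁿ` of `A`. -/
def powSub (I : Ideal A) (n : ℕ) : Submodule k A := (I ^ n).restrictScalars k

/-- The associated graded space `gr(A) = ⨁ₙ Iⁿ / Iⁿ⁺¹` of `A` for the filtration by the powers of
the ideal `I`. -/
def Gr (I : Ideal A) : Type _ :=
  DirectSum ℕ fun n => (powSub k I n) ⧸ (powSub k I (n + 1)).submoduleOf (powSub k I n)

namespace Gr

instance (I : Ideal A) : AddCommGroup (Gr k I) :=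
  inferInstanceAs (AddCommGroup (DirectSum ℕ fun n =>
    (powSub k I n) ⧸ (powSub k I (n + 1)).submoduleOf (powSub k I n)))

instance (I : Ideal A) : Module k (Gr k I) :=
  inferInstanceAs (Module k (DirectSum ℕ fun n =>
    (powSub k I n) ⧸ (powSub k I (n + 1)).submoduleOf (powSub k I n)))

/-- The class in `Iⁿ / Iⁿ⁺¹ ⊆ gr(A)` of an element of `Iⁿ`. -/
def cls (I : Ideal A) (n : ℕ) : powSub k I n →ₗ[k] Gr k I :=
  DirectSum.lof k ℕ (fun n => (powSub k I n) ⧸ (powSub k I (n + 1)).submoduleOf (powSub k I n)) n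
    ∘ₗ Submodule.mkQ _

variable {k} {I : Ideal A}

lemma powSub_anti {m n : ℕ} (h : m ≤ n) : powSub k I n ≤ powSub k I m :=
  fun _ hx => Ideal.pow_le_pow_right h hx

lemma mul_mem_powSub [I.IsTwoSided] {m n : ℕ} {x y : A} (hx : x ∈ powSub k I m)
    (hy : y ∈ powSub k I n) : x * y ∈ powSub k I (m + n) := by
  change x * y ∈ I ^ (m + n)
  rw [Ideal.IsTwoSided.pow_add]
  exact Ideal.mul_mem_mul hx hy

lemma mem_powSub_zero (x : A) : x ∈ powSub k I 0 := by
  change x ∈ I ^ 0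
  rw [Submodule.pow_zero, Ideal.one_eq_top]
  trivial

lemma cls_eq_zero {n : ℕ} (x : powSub k I n) (hx : (x : A) ∈ powSub k I (n + 1)) :
    cls k I n x = 0 := by
  have : (Submodule.mkQ ((powSub k I (n + 1)).submoduleOf (powSub k I n))) x = 0 := by
    rw [Submodule.mkQ_apply, Submodule.Quotient.mk_eq_zero]
    exact hx
  exact (congrArg (DirectSum.lof k ℕ (fun n => (powSub k I n) ⧸
    (powSub k I (n + 1)).submoduleOf (powSub k I n)) n) this).trans (map_zero _)

lemma cls_congr {m n : ℕ} (h : m = n) {x : powSub k I m} {y : powSub k I n}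
    (hxy : (x : A) = y) : cls k I m x = cls k I n y := by
  subst h
  congr 1
  exact Subtype.ext hxy

@[elab_as_elim]
lemma induction {P : Gr k I → Prop} (g : Gr k I) (h0 : P 0)
    (hadd : ∀ x y, P x → P y → P (x + y)) (hcls : ∀ n x, P (cls k I n x)) : P g := by
  refine DirectSum.induction_on (motive := P) g h0 ?_ hadd
  intro n q
  obtain ⟨x, rfl⟩ := Submodule.mkQ_surjective _ q
  exact hcls n x

/-- The linear map on `gr(A)` given by maps `Iⁿ → M` that kill `Iⁿ⁺¹`. -/
def lift {M : Type*} [AddCommGroup M] [Module k M] (f : ∀ n, powSub k I n →ₗ[k] M)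
    (hf : ∀ n (x : powSub k I n), (x : A) ∈ powSub k I (n + 1) → f n x = 0) : Gr k I →ₗ[k] M :=
  DirectSum.toModule k ℕ M fun n => Submodule.liftQ _ (f n) fun x hx => hf n x hx

@[simp] lemma lift_cls {M : Type*} [AddCommGroup M] [Module k M] (f : ∀ n, powSub k I n →ₗ[k] M)
    (hf : ∀ n (x : powSub k I n), (x : A) ∈ powSub k I (n + 1) → f n x = 0) (n : ℕ) (x : powSub k I n) :
    lift f hf (cls k I n x) = f n x := by
  refine (DirectSum.toModule_lof k n _).trans ?_
  exact Submodule.liftQ_apply _ _ _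

instance : One (Gr k I) := ⟨cls k I 0 ⟨1, mem_powSub_zero 1⟩⟩

lemma one_def : (1 : Gr k I) = cls k I 0 ⟨1, mem_powSub_zero 1⟩ := rfl

section Mul

variable [I.IsTwoSided]

/-- The product `Iᵐ × Iⁿ → Iᵐ⁺ⁿ / Iᵐ⁺ⁿ⁺¹`. -/
def mulPiece (m n : ℕ) : powSub k I m →ₗ[k] powSub k I n →ₗ[k] Gr k I :=
  LinearMap.mk₂ k (fun x y => cls k I (m + n) ⟨x * y, mul_mem_powSub x.2 y.2⟩)
    (fun x x' y => by rw [← map_add]; exact cls_congr rfl (add_mul _ _ _))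
    (fun c x y => by rw [← map_smul]; exact cls_congr rfl (smul_mul_assoc _ _ _))
    (fun x y y' => by rw [← map_add]; exact cls_congr rfl (mul_add _ _ _))
    (fun c x y => by rw [← map_smul]; exact cls_congr rfl (mul_smul_comm _ _ _))

/-- The product of `gr(A)`, as a bilinear map. -/
def mulMap : Gr k I →ₗ[k] Gr k I →ₗ[k] Gr k I :=
  lift (fun m => (lift (fun n => (mulPiece m n).flip) (fun n y hy => by
      ext x
      exact cls_eq_zero _ (by
        have := mul_mem_powSub (k := k) x.2 hy
        rwa [← add_assoc] at this))).flip)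
    (fun m x hx => by
      ext g
      induction g using Gr.induction with
      | h0 => simp
      | hadd a b ha hb => rw [map_add, map_add, ha, hb]
      | hcls n y =>
        rw [LinearMap.flip_apply, lift_cls]
        exact cls_eq_zero _ (by
          have := mul_mem_powSub (k := k) hx y.2
          rwa [add_right_comm] at this))

lemma mulMap_cls {m n : ℕ} (x : powSub k I m) (y : powSub k I n) :
    mulMap (cls k I m x) (cls k I n y) =
      cls k I (m + n) ⟨x * y, mul_mem_powSub x.2 y.2⟩ := by
  rw [mulMap, lift_cls, LinearMap.flip_apply, lift_cls]
  rfl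

instance : Mul (Gr k I) := ⟨fun g h => mulMap g h⟩

lemma mul_def (g h : Gr k I) : g * h = mulMap g h := rfl

lemma cls_mul_cls {m n : ℕ} (x : powSub k I m) (y : powSub k I n) :
    cls k I m x * cls k I n y = cls k I (m + n) ⟨x * y, mul_mem_powSub x.2 y.2⟩ :=
  mulMap_cls x y

lemma add_mul' (a b c : Gr k I) : (a + b) * c = a * c + b * c := by
  simp only [mul_def, map_add, LinearMap.add_apply]

lemma mul_add' (a b c : Gr k I) : a * (b + c) = a * b + a * c := by
  simp only [mul_def, map_add]

lemma zero_mul' (a : Gr k I) : 0 * a = 0 := by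
  simp only [mul_def, map_zero, LinearMap.zero_apply]

lemma mul_zero' (a : Gr k I) : a * 0 = 0 := by
  simp only [mul_def, map_zero]

lemma one_mul' (a : Gr k I) : 1 * a = a := by
  induction a using Gr.induction with
  | h0 => exact mul_zero' _
  | hadd a b ha hb => rw [mul_add', ha, hb]
  | hcls n x => rw [one_def, cls_mul_cls]; exact cls_congr (zero_add n) (one_mul _)

lemma mul_one' (a : Gr k I) : a * 1 = a := by
  induction a using Gr.induction with
  | h0 => exact zero_mul' _
  | hadd a b ha hb => rw [add_mul', ha, hb]
  | hcls n x => rw [one_def, cls_mul_cls]; exact cls_congr (add_zero n) (mul_one _)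

lemma mul_assoc' (a b c : Gr k I) : a * b * c = a * (b * c) := by
  induction a using Gr.induction with
  | h0 => simp only [zero_mul']
  | hadd a a' h h' => simp only [add_mul', h, h']
  | hcls m x =>
    induction b using Gr.induction with
    | h0 => simp only [zero_mul', mul_zero']
    | hadd b b' h h' => simp only [add_mul', mul_add', h, h']
    | hcls n y =>
      induction c using Gr.induction with
      | h0 => simp only [mul_zero']
      | hadd c c' h h' => simp only [mul_add', h, h']
      | hcls l z =>
        simp only [cls_mul_cls]
        exact cls_congr (add_assoc _ _ _) (mul_assoc _ _ _)

/-- The ring structure of `gr(A)`; the product of the classes of `x ∈ Iᵐ` and `y ∈ Iⁿ` is the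
class of `x y` in `Iᵐ⁺ⁿ / Iᵐ⁺ⁿ⁺¹`. -/
instance : Ring (Gr k I) :=
  { (inferInstance : AddCommGroup (Gr k I)) with
    mul := (· * ·)
    one := 1
    left_distrib := mul_add'
    right_distrib := add_mul'
    zero_mul := zero_mul'
    mul_zero := mul_zero'
    mul_assoc := mul_assoc'
    one_mul := one_mul'
    mul_one := mul_one' }

instance : Algebra k (Gr k I) :=
  Algebra.ofModule
    (fun r x y => by simp only [mul_def, map_smul, LinearMap.smul_apply])
    (fun r x y => by simp only [mul_def, map_smul])

end Mul

lemma exists_sym (k : Type*) [Field k] [Algebra k A] (I : Ideal A) (n : ℕ) :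
    ∃ p : A →ₗ[k] Gr k I, p ∘ₗ (powSub k I n).subtype = cls k I n :=
  LinearMap.exists_extend _

variable (k I) in
/-- The filtration of `A` by the powers of `I`, with `gr(A)` as the space of leading terms. -/
def filt : Filt k A (Gr k I) where
  fil := powSub k I
  sym n := (exists_sym k I n).choose
  fil_succ_le n := powSub_anti (Nat.le_succ n)
  sym_succ := by
    intro n x hx
    have hx' := powSub_anti (Nat.le_succ n) hx
    have := LinearMap.congr_fun (exists_sym k I n).choose_spec ⟨x, hx'⟩
    exact this.trans (cls_eq_zero _ hx)

lemma filt_sym {n : ℕ} (x : powSub k I n) : (filt k I).sym n x = cls k I n x :=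
  LinearMap.congr_fun (exists_sym k I n).choose_spec x

lemma filt_isMult [I.IsTwoSided] : (filt k I).IsMult where
  top := by
    rw [eq_top_iff]
    exact fun x _ => mem_powSub_zero (k := k) x
  one := filt_sym ⟨1, mem_powSub_zero 1⟩
  mul := by
    rintro m n l rfl x hx y hy
    refine ⟨mul_mem_powSub hx hy, ?_⟩
    rw [filt_sym ⟨x, hx⟩, filt_sym ⟨y, hy⟩, cls_mul_cls]
    exact filt_sym ⟨x * y, mul_mem_powSub hx hy⟩

/-- The leading part of degree `0` of a filtered linear map on `A`: it takes the class of
`x ∈ Iⁿ` to the leading term of degree `n` of `f x`. -/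
def leading {W G' : Type*} [AddCommGroup W] [Module k W] [AddCommGroup G'] [Module k G']
    (P : Filt k W G') (f : A →ₗ[k] W) (hf : ∀ n, ∀ x ∈ powSub k I n, f x ∈ P.fil n) :
    Gr k I →ₗ[k] G' :=
  lift (fun n => P.sym n ∘ₗ f ∘ₗ (powSub k I n).subtype)
    (fun n _ hx => P.sym_succ n _ (hf _ _ hx))

lemma leading_cls {W G' : Type*} [AddCommGroup W] [Module k W] [AddCommGroup G'] [Module k G']
    (P : Filt k W G') (f : A →ₗ[k] W) (hf : ∀ n, ∀ x ∈ powSub k I n, f x ∈ P.fil n) (n : ℕ)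
    (x : powSub k I n) : leading P f hf (cls k I n x) = P.sym n (f x) :=
  lift_cls _ _ n x

lemma compat_leading {W G' : Type*} [AddCommGroup W] [Module k W] [AddCommGroup G'] [Module k G']
    (P : Filt k W G') (f : A →ₗ[k] W) (hf : ∀ n, ∀ x ∈ powSub k I n, f x ∈ P.fil n) :
    Filt.Compat (filt k I) P 0 f (leading P f hf) := by
  intro n m hm x hx
  obtain rfl : m = n := hm
  refine ⟨hf m x hx, ?_⟩
  rw [filt_sym ⟨x, hx⟩, leading, lift_cls]
  rfl

/-- Maps out of `gr(A)` that are leading parts of the same map agree. -/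
lemma eq_of_compat {W G' : Type*} [AddCommGroup W] [Module k W] [AddCommGroup G'] [Module k G']
    {P : Filt k W G'} {f f' : A → W} (f₀ f₀' : Gr k I →ₗ[k] G')
    (h : Filt.Compat (filt k I) P 0 f f₀) (h' : Filt.Compat (filt k I) P 0 f' f₀')
    (hff : ∀ x, f x = f' x) (g : Gr k I) : f₀ g = f₀' g := by
  induction g using Gr.induction with
  | h0 => simp
  | hadd a b ha hb => rw [map_add, map_add, ha, hb]
  | hcls n x =>
    rw [← filt_sym, (h n n rfl x x.2).2, (h' n n rfl x x.2).2, hff]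

end Gr

end Graded

/-! ## Structure maps and leading terms -/

section StructureMaps

open Filt

variable {k : Type*} [Field k] {A B : Type*} [Ring A] [Algebra k A] [Ring B] [Algebra k B]
  {P : Filt k A B}

namespace Filt

lemma IsMult.unit (k : Type*) [Field k] : (unit k).IsMult where
  top := by simp [Filt.unit]
  one := by simp [Filt.unit]
  mul := by
    rintro m n l rfl x hx y hy
    rcases m with _ | m
    · rcases n with _ | n
      · simp [Filt.unit]
      · obtain rfl : y = 0 := by simpa [Filt.unit] using hy
        simp
    · obtain rfl : x = 0 := by simpa [Filt.unit] using hx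
      simp

lemma IsMult.compat_mulLeft (h : P.IsMult) (a : A) :
    Compat P P 0 (LinearMap.mulLeft k a) (LinearMap.mulLeft k (P.sym 0 a)) := by
  intro n m hm x hx
  obtain ⟨h1, h2⟩ := h.mul 0 n m (by omega) a (h.mem a) x hx
  exact ⟨h1, h2.symm⟩

lemma IsMult.compat_mulRight (h : P.IsMult) (a : A) :
    Compat P P 0 (LinearMap.mulRight k a) (LinearMap.mulRight k (P.sym 0 a)) := by
  intro n m hm x hx
  obtain ⟨h1, h2⟩ := h.mul n 0 m (by omega) x hx a (h.mem a)
  exact ⟨h1, h2.symm⟩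

lemma IsMult.compat_mul (h : P.IsMult) :
    Compat (P.tensor P) P 0 (LinearMap.mul' k A) (LinearMap.mul' k B) := by
  refine Compat.of_tmul _ _ ?_
  intro i j m hm x hx y hy
  obtain ⟨h1, h2⟩ := h.mul i j m (by omega) x hx y hy
  rw [LinearMap.mul'_apply, LinearMap.mul'_apply]
  exact ⟨h1, h2.symm⟩

lemma IsMult.compat_one_tmul (h : P.IsMult) {V G : Type*} [AddCommGroup V] [Module k V]
    [AddCommGroup G] [Module k G] (R : Filt k V G) :
    Compat R (P.tensor R) 0 (fun x => (1 : A) ⊗ₜ[k] x) (fun x => (1 : B) ⊗ₜ[k] x) := by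
  intro n m hm x hx
  obtain rfl : m = n := hm
  refine ⟨tmul_mem P R (zero_add m).symm (h.mem 1) hx, ?_⟩
  rw [sym_tmul P R (zero_add m).symm (h.mem 1) hx, h.one]

lemma IsMult.compat_tmul_one (h : P.IsMult) {V G : Type*} [AddCommGroup V] [Module k V]
    [AddCommGroup G] [Module k G] (R : Filt k V G) :
    Compat R (R.tensor P) 0 (fun x => x ⊗ₜ[k] (1 : A)) (fun x => x ⊗ₜ[k] (1 : B)) := by
  intro n m hm x hx
  obtain rfl : m = n := hm
  refine ⟨tmul_mem R P (add_zero m).symm hx (h.mem 1), ?_⟩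
  rw [sym_tmul R P (add_zero m).symm hx (h.mem 1), h.one]

section Comul

variable {Δ : A →ₐ[k] A ⊗[k] A} {Δ₀ : B →ₐ[k] B ⊗[k] B}

lemma compat_idComul (h : Compat P (P.tensor P) 0 Δ Δ₀) :
    Compat (P.tensor P) (P.tensor (P.tensor P)) 0 (idComul k Δ) (idComul k Δ₀) :=
  Compat.map (f := LinearMap.id) (f₀ := LinearMap.id) (g := Δ.toLinearMap)
    (g₀ := Δ₀.toLinearMap) (Compat.id P) h

lemma compat_comulId (h : Compat P (P.tensor P) 0 Δ Δ₀) :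
    Compat (P.tensor P) (P.tensor (P.tensor P)) 0 (comulId k Δ) (comulId k Δ₀) :=
  (Compat.assoc P P P).comp (Compat.map (g := LinearMap.id) (g₀ := LinearMap.id)
    (f := Δ.toLinearMap) (f₀ := Δ₀.toLinearMap) h (Compat.id P))

lemma compat_idIdComul (h : Compat P (P.tensor P) 0 Δ Δ₀) :
    Compat (P.tensor (P.tensor P)) (P.tensor (P.tensor (P.tensor P))) 0
      (idIdComul k Δ) (idIdComul k Δ₀) :=
  Compat.map (f := LinearMap.id) (f₀ := LinearMap.id) (g := (idComul k Δ).toLinearMap)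
    (g₀ := (idComul k Δ₀).toLinearMap) (Compat.id P) (compat_idComul h)

lemma compat_idComulId (h : Compat P (P.tensor P) 0 Δ Δ₀) :
    Compat (P.tensor (P.tensor P)) (P.tensor (P.tensor (P.tensor P))) 0
      (idComulId k Δ) (idComulId k Δ₀) :=
  Compat.map (f := LinearMap.id) (f₀ := LinearMap.id) (g := (comulId k Δ).toLinearMap)
    (g₀ := (comulId k Δ₀).toLinearMap) (Compat.id P) (compat_comulId h)

lemma compat_comulIdId (h : Compat P (P.tensor P) 0 Δ Δ₀) :
    Compat (P.tensor (P.tensor P)) (P.tensor (P.tensor (P.tensor P))) 0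
      (comulIdId k Δ) (comulIdId k Δ₀) :=
  (Compat.assoc P P (P.tensor P)).comp (Compat.map (g := LinearMap.id) (g₀ := LinearMap.id)
    (f := Δ.toLinearMap) (f₀ := Δ₀.toLinearMap) h (Compat.id (P.tensor P)))

lemma IsMult.compat_oneTensor₃ (h : P.IsMult) :
    Compat (P.tensor (P.tensor P)) (P.tensor (P.tensor (P.tensor P))) 0
      (oneTensor₃ k A) (oneTensor₃ k B) :=
  h.compat_one_tmul (P.tensor (P.tensor P))

lemma IsMult.compat_tensorOne₂ (h : P.IsMult) :
    Compat (P.tensor P) (P.tensor (P.tensor P)) 0 (tensorOne₂ k A) (tensorOne₂ k B) :=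
  Compat.map (f := LinearMap.id) (f₀ := LinearMap.id)
    (g := (Algebra.TensorProduct.includeLeft : A →ₐ[k] A ⊗[k] A).toLinearMap)
    (g₀ := (Algebra.TensorProduct.includeLeft : B →ₐ[k] B ⊗[k] B).toLinearMap)
    (Compat.id P) (h.compat_tmul_one P)

lemma IsMult.compat_tensorOne₃ (h : P.IsMult) :
    Compat (P.tensor (P.tensor P)) (P.tensor (P.tensor (P.tensor P))) 0
      (tensorOne₃ k A) (tensorOne₃ k B) :=
  Compat.map (f := LinearMap.id) (f₀ := LinearMap.id)
    (g := (tensorOne₂ k A).toLinearMap) (g₀ := (tensorOne₂ k B).toLinearMap)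
    (Compat.id P) h.compat_tensorOne₂

end Comul

section Counit

variable {ε : A →ₐ[k] k} {ε₀ : B →ₐ[k] k}

lemma compat_counitId (h : Compat P (unit k) 0 ε ε₀) :
    Compat (P.tensor P) P 0 (counitId k ε) (counitId k ε₀) :=
  (Compat.lid P).comp (Compat.map (g := LinearMap.id) (g₀ := LinearMap.id)
    (f := ε.toLinearMap) (f₀ := ε₀.toLinearMap) h (Compat.id P))

lemma compat_idCounit (h : Compat P (unit k) 0 ε ε₀) :
    Compat (P.tensor P) P 0 (idCounit k ε) (idCounit k ε₀) :=
  (Compat.rid P).comp (Compat.map (f := LinearMap.id) (f₀ := LinearMap.id)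
    (g := ε.toLinearMap) (g₀ := ε₀.toLinearMap) (Compat.id P) h)

lemma compat_idCounitId (h : Compat P (unit k) 0 ε ε₀) :
    Compat (P.tensor (P.tensor P)) (P.tensor P) 0 (idCounitId k ε) (idCounitId k ε₀) :=
  Compat.map (f := LinearMap.id) (f₀ := LinearMap.id) (g := (counitId k ε).toLinearMap)
    (g₀ := (counitId k ε₀).toLinearMap) (Compat.id P) (compat_counitId h)

lemma compat_counit_smul (h : Compat P (unit k) 0 ε ε₀) (hP : P.IsMult) (a : A) :
    Compat P P 0 (fun x => ε x • a) (fun x => ε₀ x • P.sym 0 a) := by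
  intro n m hm x hx
  obtain rfl : m = n := hm
  obtain ⟨h1, h2⟩ := h m m rfl x hx
  rcases m with _ | m
  · refine ⟨Submodule.smul_mem _ _ (hP.mem a), ?_⟩
    simp only [h2, map_smul]
    rfl
  · have h3 : ε x = 0 := by simpa [Filt.unit] using h1
    simp only [h2, h3, zero_smul, map_zero]
    exact ⟨zero_mem _, trivial⟩

end Counit

section Antipode

variable {S : A →ₗ[k] A} {S₀ : B →ₗ[k] B}

lemma IsMult.compat_sandL (hP : P.IsMult) (h : Compat P P 0 S S₀) (a : A) :
    Compat (P.tensor P) P 0 (sandL k S a) (sandL k S₀ (P.sym 0 a)) :=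
  hP.compat_mul.comp (Compat.map (g := LinearMap.id) (g₀ := LinearMap.id)
    (f := LinearMap.mulRight k a ∘ₗ S) (f₀ := LinearMap.mulRight k (P.sym 0 a) ∘ₗ S₀)
    ((hP.compat_mulRight a).comp h) (Compat.id P))

lemma IsMult.compat_sandR (hP : P.IsMult) (h : Compat P P 0 S S₀) (b : A) :
    Compat (P.tensor P) P 0 (sandR k S b) (sandR k S₀ (P.sym 0 b)) :=
  hP.compat_mul.comp (Compat.map (hP.compat_mulRight b) h)

lemma IsMult.compat_zigzagR (hP : P.IsMult) (h : Compat P P 0 S S₀) (a b : A) :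
    Compat (P.tensor (P.tensor P)) P 0 (zigzagR k S a b)
      (zigzagR k S₀ (P.sym 0 a) (P.sym 0 b)) :=
  hP.compat_mul.comp (Compat.map (hP.compat_mulRight b) (hP.compat_sandL h a))

lemma IsMult.compat_zigzagL (hP : P.IsMult) (h : Compat P P 0 S S₀) (a b : A) :
    Compat (P.tensor (P.tensor P)) P 0 (zigzagL k S a b)
      (zigzagL k S₀ (P.sym 0 a) (P.sym 0 b)) :=
  hP.compat_mul.comp (Compat.map
    (f := LinearMap.mulRight k a ∘ₗ S) (f₀ := LinearMap.mulRight k (P.sym 0 a) ∘ₗ S₀)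
    ((hP.compat_mulRight a).comp h) (hP.compat_sandR h b))

end Antipode

end Filt

namespace Gr

variable {I : Ideal A} [I.IsTwoSided]

/-- The leading part of degree `0` of a filtered algebra homomorphism. -/
def leadingAlg {W G' : Type*} [Ring W] [Algebra k W] [Ring G'] [Algebra k G']
    (R : Filt k W G') (hR : R.IsMult) (f : A →ₐ[k] W)
    (hf : ∀ n, ∀ x ∈ powSub k I n, f x ∈ R.fil n) : Gr k I →ₐ[k] G' :=
  AlgHom.ofLinearMap (leading R f.toLinearMap hf)
    (by
      have := (compat_leading R f.toLinearMap hf 0 0 rfl 1 (filt_isMult.mem 1)).2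
      rw [filt_isMult.one] at this
      rw [this, AlgHom.toLinearMap_apply, map_one, hR.one])
    (by
      intro a b
      induction a using Gr.induction with
      | h0 => rw [zero_mul, map_zero, zero_mul]
      | hadd a a' h h' => rw [add_mul, map_add, map_add, h, h', add_mul]
      | hcls m x =>
        induction b using Gr.induction with
        | h0 => rw [mul_zero, map_zero, mul_zero]
        | hadd b b' h h' => rw [mul_add, map_add, map_add, h, h', mul_add]
        | hcls n y =>
          rw [cls_mul_cls]
          refine (leading_cls R f.toLinearMap hf (m + n) _).trans (Eq.trans ?_
            (congrArg₂ (· * ·) (leading_cls R f.toLinearMap hf m x)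
              (leading_cls R f.toLinearMap hf n y)).symm)
          simp only [AlgHom.toLinearMap_apply, map_mul]
          exact (hR.mul m n _ rfl _ (hf m x x.2) _ (hf n y y.2)).2)

lemma compat_leadingAlg {W G' : Type*} [Ring W] [Algebra k W] [Ring G'] [Algebra k G']
    (R : Filt k W G') (hR : R.IsMult) (f : A →ₐ[k] W)
    (hf : ∀ n, ∀ x ∈ powSub k I n, f x ∈ R.fil n) :
    Compat (filt k I) R 0 f (leadingAlg R hR f hf) :=
  compat_leading R f.toLinearMap hf

end Gr

end StructureMaps

/-! ## The associated graded quasi-Hopf algebra -/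

namespace QuasiHopf

variable {k : Type*} [Field k] {A : Type*} [Ring A] [Algebra k A]

/-- A two-sided ideal `I` is a quasi-Hopf ideal if `Δ(I) ⊆ I ⊗ A + A ⊗ I`, `ε(I) = 0` and
`S(I) ⊆ I`. -/
structure IsQuasiHopfIdeal (Q : QuasiHopf k A) (I : Ideal A) [I.IsTwoSided] : Prop where
  comul_mem : ∀ x ∈ I, Q.comul x ∈
    Submodule.map₂ (TensorProduct.mk k A A) (I.restrictScalars k) ⊤ ⊔
      Submodule.map₂ (TensorProduct.mk k A A) ⊤ (I.restrictScalars k)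
  counit_eq_zero : ∀ x ∈ I, Q.counit x = 0
  antipode_mem : ∀ x ∈ I, Q.antipode x ∈ I

namespace IsQuasiHopfIdeal

variable {Q : QuasiHopf k A} {I : Ideal A} [I.IsTwoSided]

lemma comul_pow (h : Q.IsQuasiHopfIdeal I) (n : ℕ) (x : A) (hx : x ∈ powSub k I n) :
    Q.comul x ∈ ((Gr.filt k I).tensor (Gr.filt k I)).fil n := by
  have hM : ((Gr.filt k I).tensor (Gr.filt k I)).IsMult := Gr.filt_isMult.tensor Gr.filt_isMult
  induction n generalizing x with
  | zero => exact hM.mem _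
  | succ n ih =>
    change x ∈ I ^ (n + 1) at hx
    rw [Submodule.pow_succ] at hx
    refine Submodule.mul_induction_on hx ?_ ?_
    · intro a ha b hb
      rw [map_mul]
      refine (hM.mul n 1 _ rfl _ (ih a ha) _ ?_).1
      have hb1 : b ∈ I := hb
      have hle : Submodule.map₂ (TensorProduct.mk k A A) (I.restrictScalars k) ⊤ ⊔
          Submodule.map₂ (TensorProduct.mk k A A) ⊤ (I.restrictScalars k) ≤
          ((Gr.filt k I).tensor (Gr.filt k I)).fil 1 := by
        refine sup_le (Submodule.map₂_le.2 ?_) (Submodule.map₂_le.2 ?_)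
        · intro y hy z _
          refine Filt.tmul_mem _ _ (i := 1) (j := 0) rfl ?_ (Gr.mem_powSub_zero z)
          change y ∈ I ^ 1
          rw [Submodule.pow_one]
          exact hy
        · intro y _ z hz
          refine Filt.tmul_mem _ _ (i := 0) (j := 1) rfl (Gr.mem_powSub_zero y) ?_
          change z ∈ I ^ 1
          rw [Submodule.pow_one]
          exact hz
      exact hle (h.comul_mem b hb1)
    · intro a b ha hb
      rw [map_add]
      exact add_mem ha hb

lemma counit_pow (h : Q.IsQuasiHopfIdeal I) (n : ℕ) (x : A) (hx : x ∈ powSub k I n) :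
    Q.counit x ∈ (Filt.unit k).fil n := by
  rcases n with _ | n
  · simp [Filt.unit]
  · have : Q.counit x = 0 := h.counit_eq_zero x (Ideal.pow_le_self (Nat.succ_ne_zero n) hx)
    rw [this]
    exact zero_mem _

lemma antipode_pow (h : Q.IsQuasiHopfIdeal I) (n : ℕ) (x : A) (hx : x ∈ powSub k I n) :
    Q.antipode x ∈ powSub k I n := by
  induction n generalizing x with
  | zero => exact Gr.mem_powSub_zero _
  | succ n ih =>
    change x ∈ I ^ (n + 1) at hx
    rw [Submodule.pow_succ] at hx
    refine Submodule.mul_induction_on hx ?_ ?_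
    · intro a ha b hb
      rw [Q.antipode_mul]
      change _ ∈ I ^ (n + 1)
      rw [Ideal.IsTwoSided.pow_succ]
      exact Ideal.mul_mem_mul (h.antipode_mem b hb) (ih a ha)
    · intro a b ha hb
      rw [map_add]
      exact add_mem ha hb

lemma antipode_symm_pow (h : Q.IsQuasiHopfIdeal I) [FiniteDimensional k A] (n : ℕ) (x : A) (hx : x ∈ powSub k I n) :
    (LinearEquiv.ofBijective Q.antipode Q.antipode_bijective).symm x ∈ powSub k I n := by
  have hle : (powSub k I n).map Q.antipode ≤ powSub k I n := by
    rintro _ ⟨y, hy, rfl⟩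
    exact h.antipode_pow n y hy
  have heq : (powSub k I n).map Q.antipode = powSub k I n :=
    Submodule.eq_of_le_of_finrank_eq hle
      (LinearEquiv.finrank_eq
        (Submodule.equivMapOfInjective Q.antipode Q.antipode_bijective.1 _).symm)
  rw [← heq] at hx
  obtain ⟨y, hy, rfl⟩ := hx
  have : (LinearEquiv.ofBijective Q.antipode Q.antipode_bijective).symm (Q.antipode y) = y :=
    LinearEquiv.symm_apply_apply (LinearEquiv.ofBijective Q.antipode Q.antipode_bijective) y
  rw [this]
  exact hy

/-- The antipode of `gr(A)`: the class of `x ∈ Iⁿ` goes to the class of `S(x) ∈ Iⁿ`. -/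
def grAntipode (h : Q.IsQuasiHopfIdeal I) : Gr k I →ₗ[k] Gr k I :=
  Gr.leading (Gr.filt k I) Q.antipode h.antipode_pow

lemma grAntipode_compat (h : Q.IsQuasiHopfIdeal I) :
    Filt.Compat (Gr.filt k I) (Gr.filt k I) 0 Q.antipode h.grAntipode :=
  Gr.compat_leading _ _ _

lemma grAntipode_bijective (h : Q.IsQuasiHopfIdeal I) [FiniteDimensional k A] : Function.Bijective h.grAntipode := by
  set e := LinearEquiv.ofBijective Q.antipode Q.antipode_bijective with he
  have hc := Gr.compat_leading (Gr.filt k I) e.symm.toLinearMap h.antipode_symm_pow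
  have hS := h.grAntipode_compat
  refine Function.bijective_iff_has_inverse.2
    ⟨Gr.leading (Gr.filt k I) e.symm.toLinearMap h.antipode_symm_pow, fun g => ?_, fun g => ?_⟩
  · exact Gr.eq_of_compat ((Gr.leading (Gr.filt k I) e.symm.toLinearMap h.antipode_symm_pow) ∘ₗ
      h.grAntipode) LinearMap.id (hc.comp hS) (Filt.Compat.id _)
      (fun x => e.symm_apply_apply x) g
  · exact Gr.eq_of_compat (h.grAntipode ∘ₗ
      (Gr.leading (Gr.filt k I) e.symm.toLinearMap h.antipode_symm_pow)) LinearMap.id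
      (hS.comp hc) (Filt.Compat.id _) (fun x => e.apply_symm_apply x) g

/-- The coproduct of `gr(A)`: the class of `x ∈ Iⁿ` goes to the leading term, in
`⨁_{i + j = n} Iⁱ / Iⁱ⁺¹ ⊗ Iʲ / Iʲ⁺¹`, of `Δ(x) ∈ ∑_{i + j = n} Iⁱ ⊗ Iʲ`. -/
def grComul (h : Q.IsQuasiHopfIdeal I) : Gr k I →ₐ[k] Gr k I ⊗[k] Gr k I :=
  Gr.leadingAlg ((Gr.filt k I).tensor (Gr.filt k I)) (Gr.filt_isMult.tensor Gr.filt_isMult)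
    Q.comul h.comul_pow

lemma grComul_compat (h : Q.IsQuasiHopfIdeal I) :
    Filt.Compat (Gr.filt k I) ((Gr.filt k I).tensor (Gr.filt k I)) 0 Q.comul h.grComul :=
  Gr.compat_leadingAlg _ _ _ _

/-- The counit of `gr(A)`: `ε` in degree `0`, and `0` in positive degrees. -/
def grCounit (h : Q.IsQuasiHopfIdeal I) : Gr k I →ₐ[k] k :=
  Gr.leadingAlg (Filt.unit k) (Filt.IsMult.unit k) Q.counit h.counit_pow

lemma grCounit_compat (h : Q.IsQuasiHopfIdeal I) : Filt.Compat (Gr.filt k I) (Filt.unit k) 0 Q.counit h.grCounit :=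
  Gr.compat_leadingAlg _ _ _ _

end IsQuasiHopfIdeal

lemma filt_isMult₃ (I : Ideal A) [I.IsTwoSided] :
    ((Gr.filt k I).tensor ((Gr.filt k I).tensor (Gr.filt k I))).IsMult :=
  Gr.filt_isMult.tensor (Gr.filt_isMult.tensor Gr.filt_isMult)

lemma filt_isMult₄ (I : Ideal A) [I.IsTwoSided] :
    ((Gr.filt k I).tensor
      ((Gr.filt k I).tensor ((Gr.filt k I).tensor (Gr.filt k I)))).IsMult :=
  Gr.filt_isMult.tensor (filt_isMult₃ I)

/-- The associated graded quasi-Hopf algebra `gr(A) = ⨁ₙ Iⁿ / Iⁿ⁺¹` of a finite dimensional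
quasi-Hopf algebra `A` for the filtration by the powers of a quasi-Hopf ideal `I`. Its associator
is the degree `0` part of `Φ`, the image of `Φ` in `(A / I) ⊗ (A / I) ⊗ (A / I)`. -/
def gr [FiniteDimensional k A] (Q : QuasiHopf k A) (I : Ideal A) [I.IsTwoSided]
    (h : Q.IsQuasiHopfIdeal I) : QuasiHopf k (Gr k I) where
  comul := h.grComul
  counit := h.grCounit
  assoc := Units.map (filt_isMult₃ (k := k) I).sym₀ Q.assoc
  antipode := h.grAntipode
  alpha := Gr.cls k I 0 ⟨Q.alpha, Gr.mem_powSub_zero _⟩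
  beta := Gr.cls k I 0 ⟨Q.beta, Gr.mem_powSub_zero _⟩
  quasi_coassoc := by
    have hM := filt_isMult₃ (k := k) I
    exact Gr.eq_of_compat
      ((idComul k h.grComul).toLinearMap ∘ₗ h.grComul.toLinearMap)
      (LinearMap.mulRight k (hM.sym₀ ↑Q.assoc⁻¹) ∘ₗ LinearMap.mulLeft k (hM.sym₀ ↑Q.assoc) ∘ₗ
        (comulId k h.grComul).toLinearMap ∘ₗ h.grComul.toLinearMap)
      ((Filt.compat_idComul h.grComul_compat).comp h.grComul_compat)
      ((hM.compat_mulRight _).comp ((hM.compat_mulLeft _).comp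
        ((Filt.compat_comulId h.grComul_compat).comp h.grComul_compat)))
      Q.quasi_coassoc
  pentagon := by
    have hM := filt_isMult₃ (k := k) I
    have hM4 := filt_isMult₄ (k := k) I
    have hΦ := hM.mem (↑Q.assoc)
    have e1 := (Filt.compat_idIdComul h.grComul_compat 0 0 rfl _ hΦ).2
    have e2 := (Filt.compat_comulIdId h.grComul_compat 0 0 rfl _ hΦ).2
    have e3 := (Filt.compat_idComulId h.grComul_compat 0 0 rfl _ hΦ).2
    have e4 := ((Gr.filt_isMult (k := k) (I := I)).compat_oneTensor₃ 0 0 rfl _ hΦ).2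
    have e5 := ((Gr.filt_isMult (k := k) (I := I)).compat_tensorOne₃ 0 0 rfl _ hΦ).2
    refine (congrArg₂ (· * ·) e1 e2).trans (Eq.trans ?_
      (congrArg₂ (· * ·) (congrArg₂ (· * ·) e4 e3) e5).symm)
    have := congrArg hM4.sym₀ Q.pentagon
    rw [map_mul, map_mul, map_mul] at this
    exact this
  counit_comul := Gr.eq_of_compat
      ((counitId k h.grCounit).toLinearMap ∘ₗ h.grComul.toLinearMap) LinearMap.id
      ((Filt.compat_counitId h.grCounit_compat).comp h.grComul_compat) (Filt.Compat.id _)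
      Q.counit_comul
  comul_counit := Gr.eq_of_compat
      ((idCounit k h.grCounit).toLinearMap ∘ₗ h.grComul.toLinearMap) LinearMap.id
      ((Filt.compat_idCounit h.grCounit_compat).comp h.grComul_compat) (Filt.Compat.id _)
      Q.comul_counit
  counit_assoc := by
    have hM := filt_isMult₃ (k := k) I
    have hM2 : ((Gr.filt k I).tensor (Gr.filt k I)).IsMult :=
      Gr.filt_isMult.tensor Gr.filt_isMult
    have := (Filt.compat_idCounitId h.grCounit_compat 0 0 rfl _ (hM.mem ↑Q.assoc)).2
    rw [Q.counit_assoc, hM2.one] at this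
    exact this
  antipode_one := by
    have := (h.grAntipode_compat 0 0 rfl 1 (Gr.filt_isMult.mem 1)).2
    rw [Q.antipode_one, Gr.filt_isMult.one] at this
    exact this
  antipode_mul := by
    intro a b
    have hM := Gr.filt_isMult (k := k) (I := I)
    induction a using Gr.induction with
    | h0 => rw [zero_mul, map_zero, mul_zero]
    | hadd a a' h h' => rw [add_mul, map_add, map_add, h, h', mul_add]
    | hcls m x =>
      induction b using Gr.induction with
      | h0 => rw [mul_zero, map_zero, zero_mul]
      | hadd b b' h h' => rw [mul_add, map_add, map_add, h, h', add_mul]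
      | hcls n y =>
        obtain ⟨h1, h2⟩ := hM.mul m n _ rfl x x.2 y y.2
        obtain ⟨h3, h4⟩ := h.grAntipode_compat m m rfl x x.2
        obtain ⟨h5, h6⟩ := h.grAntipode_compat n n rfl y y.2
        have h7 := (h.grAntipode_compat (m + n) (m + n) rfl _ h1).2
        rw [← Gr.filt_sym, ← Gr.filt_sym, ← h2, h4, h6,
          h7, Q.antipode_mul,
          (hM.mul n m (m + n) (add_comm _ _) _ h5 _ h3).2]
  antipode_bijective := h.grAntipode_bijective
  antipode_left := by
    have hM := Gr.filt_isMult (k := k) (I := I)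
    rw [← Gr.filt_sym ⟨Q.alpha, Gr.mem_powSub_zero _⟩]
    exact Gr.eq_of_compat
      (sandL k h.grAntipode ((Gr.filt k I).sym 0 Q.alpha) ∘ₗ h.grComul.toLinearMap)
      (h.grCounit.toLinearMap.smulRight ((Gr.filt k I).sym 0 Q.alpha))
      ((hM.compat_sandL h.grAntipode_compat Q.alpha).comp h.grComul_compat)
      (Filt.compat_counit_smul h.grCounit_compat hM Q.alpha) Q.antipode_left
  antipode_right := by
    have hM := Gr.filt_isMult (k := k) (I := I)
    rw [← Gr.filt_sym ⟨Q.beta, Gr.mem_powSub_zero _⟩]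
    exact Gr.eq_of_compat
      (sandR k h.grAntipode ((Gr.filt k I).sym 0 Q.beta) ∘ₗ h.grComul.toLinearMap)
      (h.grCounit.toLinearMap.smulRight ((Gr.filt k I).sym 0 Q.beta))
      ((hM.compat_sandR h.grAntipode_compat Q.beta).comp h.grComul_compat)
      (Filt.compat_counit_smul h.grCounit_compat hM Q.beta) Q.antipode_right
  zigzag_assoc := by
    have hM := Gr.filt_isMult (k := k) (I := I)
    rw [← Gr.filt_sym ⟨Q.alpha, Gr.mem_powSub_zero _⟩,
      ← Gr.filt_sym ⟨Q.beta, Gr.mem_powSub_zero _⟩]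
    have := (hM.compat_zigzagR h.grAntipode_compat Q.alpha Q.beta 0 0 rfl ↑Q.assoc
      ((filt_isMult₃ I).mem _)).2
    rw [Q.zigzag_assoc, hM.one] at this
    exact this
  zigzag_assoc_inv := by
    have hM := Gr.filt_isMult (k := k) (I := I)
    rw [← Gr.filt_sym ⟨Q.alpha, Gr.mem_powSub_zero _⟩,
      ← Gr.filt_sym ⟨Q.beta, Gr.mem_powSub_zero _⟩]
    have := (hM.compat_zigzagL h.grAntipode_compat Q.alpha Q.beta 0 0 rfl ↑Q.assoc⁻¹
      ((filt_isMult₃ I).mem _)).2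
    rw [Q.zigzag_assoc_inv, hM.one] at this
    exact this

end QuasiHopf

end QH

end

/-! This is obstruction theory along the radical filtration. The radical `I` is nilpotent, so the
induced filtration on `A ⊗ A ⊗ A` is finite, and it suffices to find twists whose associator agrees
with `1` to higher and higher order. Order one is the assumption on the associator of `gr(A)`, which
is the degree `0` part of `Φ`.

Suppose that `Ψ = Φ^J` lies in `1 + fil n`, with `n ≥ 1` and `J ∈ 1 + fil 1`. Modulo `fil (n + 1)`,
multiplication in `1 + fil n` is addition of leading terms (`IsMult.sym_mul_sub_one`), and the
twisted coproduct still has the coproduct of `gr(A)` as leading part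
(`IsQuasiHopfIdeal.twistComul_compat`). The pentagon for `Ψ` (`pentagon_twist`) therefore
linearises: the leading term `t` of `Ψ - 1` is a 3-cocycle of the cobar complex of `gr(A)`. By
finite dimensional duality this complex is the Hochschild complex of `gr(A)*` with trivial
coefficients, so `t` is the coboundary of some `j` (`exists_eq_coboundary`). Lift the degree `n`
component of `j` to `g ∈ fil n` and twist further by `F = 1 - g`: to first order this subtracts the
coboundary `t` from the associator, which is then in `1 + fil (n + 1)` (`exists_twistAssoc_step`,
using `twistAssoc_mul`). Iteration gives an invertible `J` with `Φ^J = 1`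
(`exists_twistAssoc_eq_one`).

Two normalisations remain. The counit conditions hold up to one common scalar, because applying `id
⊗ ε ⊗ id` to `Φ^J = 1` gives `1 ⊗ (ε ⊗ id)(J) = (id ⊗ ε)(J) ⊗ 1`; dividing `J` by that scalar does
not change `Φ^J` (`exists_isTwist`). Then the zigzag axiom gives `β^J α^J = 1`
(`twistBeta_mul_twistAlpha`). In finite dimension the two elements are mutually inverse, so the
change of `(S, α, β)` by `u = β^J` makes both equal to `1` (`exists_twistEquivalent`). -/

noncomputable section

namespace QH

/-! ### Relations between the coface maps on tensor powers of `A`. -/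

section StructureMapIdentities

variable {k : Type*} [Field k] {A : Type*} [Ring A] [Algebra k A]

/-- Triple tensors are nested to the right, so `t ⊗ 1` needs a reassociation before `t` appears as a
single factor. -/
lemma tensorOne₂_eq_assoc (t : A ⊗[k] A) :
    tensorOne₂ k A t = Algebra.TensorProduct.assoc k k k A A A (t ⊗ₜ 1) := by
  induction t with
  | zero => simp
  | add a b ha hb => rw [map_add, ha, hb, TensorProduct.add_tmul, map_add]
  | tmul x y => simp [tensorOne₂]

lemma tensorOne₃_tensorOne₂ (t : A ⊗[k] A) :
    tensorOne₃ k A (tensorOne₂ k A t) =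
      Algebra.TensorProduct.assoc k k k A A (A ⊗[k] A) (t ⊗ₜ 1) := by
  induction t with
  | zero => simp
  | add a b ha hb => rw [map_add, map_add, ha, hb, TensorProduct.add_tmul, map_add]
  | tmul x y => simp [tensorOne₂, tensorOne₃, Algebra.TensorProduct.one_def]

lemma tensorOne₃_oneTensor₂ (t : A ⊗[k] A) :
    tensorOne₃ k A (oneTensor₂ k A t) = oneTensor₃ k A (tensorOne₂ k A t) := by
  simp [tensorOne₃, oneTensor₂, oneTensor₃]

/-- The two elements occupy disjoint legs, 1, 2 and 3, 4. -/
lemma commute_tensorOne₃_oneTensor₃ (s t : A ⊗[k] A) :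
    Commute (tensorOne₃ k A (tensorOne₂ k A s)) (oneTensor₃ k A (oneTensor₂ k A t)) := by
  have h : oneTensor₃ k A (oneTensor₂ k A t) =
      Algebra.TensorProduct.assoc k k k A A (A ⊗[k] A) (1 ⊗ₜ t) := by
    simp [oneTensor₂, oneTensor₃, Algebra.TensorProduct.one_def]
  rw [tensorOne₃_tensorOne₂, h]
  refine Commute.map (f := Algebra.TensorProduct.assoc k k k A A (A ⊗[k] A)) ?_
  simp [commute_iff_eq]

variable (Δ : A →ₐ[k] A ⊗[k] A)

lemma idIdComul_oneTensor₂ (t : A ⊗[k] A) :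
    idIdComul k Δ (oneTensor₂ k A t) = oneTensor₃ k A (idComul k Δ t) := by
  simp [idIdComul, oneTensor₂, oneTensor₃]

lemma idComulId_oneTensor₂ (t : A ⊗[k] A) :
    idComulId k Δ (oneTensor₂ k A t) = oneTensor₃ k A (comulId k Δ t) := by
  simp [idComulId, oneTensor₂, oneTensor₃]

lemma comulIdId_oneTensor₂ (t : A ⊗[k] A) :
    comulIdId k Δ (oneTensor₂ k A t) = oneTensor₃ k A (oneTensor₂ k A t) := by
  simp [comulIdId, oneTensor₂, oneTensor₃, Algebra.TensorProduct.one_def]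

lemma idIdComul_tensorOne₂ (t : A ⊗[k] A) :
    idIdComul k Δ (tensorOne₂ k A t) = tensorOne₃ k A (tensorOne₂ k A t) := by
  induction t with
  | zero => simp
  | add a b ha hb => simp only [map_add, ha, hb]
  | tmul x y => simp [idIdComul, idComul, tensorOne₂, tensorOne₃, Algebra.TensorProduct.one_def]

lemma idComulId_tensorOne₂ (t : A ⊗[k] A) :
    idComulId k Δ (tensorOne₂ k A t) = tensorOne₃ k A (idComul k Δ t) := by
  induction t with
  | zero => simp
  | add a b ha hb => simp only [map_add, ha, hb]
  | tmul x y =>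
    simp [idComulId, comulId, idComul, tensorOne₂, tensorOne₃]
    exact congrArg _ (tensorOne₂_eq_assoc (Δ y)).symm

lemma comulIdId_tensorOne₂ (t : A ⊗[k] A) :
    comulIdId k Δ (tensorOne₂ k A t) = tensorOne₃ k A (comulId k Δ t) := by
  induction t with
  | zero => simp
  | add a b ha hb => simp only [map_add, ha, hb]
  | tmul x y =>
    simp [comulIdId, comulId, tensorOne₂, tensorOne₃]
    induction Δ x with
    | zero => simp
    | add a b ha hb => simp only [map_add, TensorProduct.add_tmul, ha, hb]
    | tmul z w => simp

/-- Both composites are `Δ ⊗ Δ`. -/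
lemma idIdComul_comulId (t : A ⊗[k] A) :
    idIdComul k Δ (comulId k Δ t) = comulIdId k Δ (idComul k Δ t) := by
  induction t with
  | zero => simp
  | add a b ha hb => simp only [map_add, ha, hb]
  | tmul x y =>
    simp [idIdComul, comulIdId, comulId, idComul]
    induction Δ x with
    | zero => simp
    | add a b ha hb => simp only [map_add, TensorProduct.add_tmul, ha, hb]
    | tmul z w => simp

/-- `(X, v) ↦ X ⊗ v`, from `(A ⊗ A ⊗ A) × A` to `A ⊗ A ⊗ A ⊗ A`. -/
def appendRight (v : A) : A ⊗[k] (A ⊗[k] A) →ₗ[k] A ⊗[k] (A ⊗[k] (A ⊗[k] A)) :=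
  TensorProduct.map LinearMap.id (TensorProduct.map LinearMap.id
    ((TensorProduct.mk k A A).flip v))

lemma appendRight_mul_tensorOne₃ (v : A) (X Y : A ⊗[k] (A ⊗[k] A)) :
    appendRight v (X * Y) = appendRight v X * tensorOne₃ k A Y := by
  induction X with
  | zero => simp
  | add a b ha hb => simp only [map_add, add_mul, ha, hb]
  | tmul x X =>
    induction X with
    | zero => simp
    | add a b ha hb => simp only [map_add, TensorProduct.tmul_add, add_mul, ha, hb]
    | tmul x' x'' =>
      induction Y with
      | zero => simp
      | add a b ha hb => simp only [map_add, mul_add, ha, hb]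
      | tmul y Y =>
        induction Y with
        | zero => simp
        | add a b ha hb => simp only [map_add, TensorProduct.tmul_add, mul_add, ha, hb]
        | tmul y' y'' => simp [appendRight, tensorOne₃, tensorOne₂]

lemma tensorOne₃_mul_appendRight (v : A) (X Y : A ⊗[k] (A ⊗[k] A)) :
    appendRight v (X * Y) = tensorOne₃ k A X * appendRight v Y := by
  induction X with
  | zero => simp
  | add a b ha hb => simp only [map_add, add_mul, ha, hb]
  | tmul x X =>
    induction X with
    | zero => simp
    | add a b ha hb => simp only [map_add, TensorProduct.tmul_add, add_mul, ha, hb]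
    | tmul x' x'' =>
      induction Y with
      | zero => simp
      | add a b ha hb => simp only [map_add, mul_add, ha, hb]
      | tmul y Y =>
        induction Y with
        | zero => simp
        | add a b ha hb => simp only [map_add, TensorProduct.tmul_add, mul_add, ha, hb]
        | tmul y' y'' => simp [appendRight, tensorOne₃, tensorOne₂]

/-- The factor `y` is inert; isolating it through `appendRight` lets quasi-coassociativity act on
`x` alone. -/
lemma idComulId_comulId_tmul (x y : A) :
    idComulId k Δ (comulId k Δ (x ⊗ₜ y)) = appendRight y (idComul k Δ (Δ x)) := by
  simp [idComulId, comulId, idComul]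
  induction Δ x with
  | zero => simp
  | add a b ha hb => simp only [map_add, TensorProduct.add_tmul, ha, hb]
  | tmul z w =>
    simp [appendRight]
    congr 1
    induction Δ w with
    | zero => simp
    | add a b ha hb => simp only [map_add, TensorProduct.add_tmul, ha, hb]
    | tmul z w => simp

lemma comulIdId_comulId_tmul (x y : A) :
    comulIdId k Δ (comulId k Δ (x ⊗ₜ y)) = appendRight y (comulId k Δ (Δ x)) := by
  simp [comulIdId, comulId]
  induction Δ x with
  | zero => simp
  | add a b ha hb => simp only [map_add, TensorProduct.add_tmul, ha, hb]
  | tmul z w =>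
    simp [appendRight]
    induction Δ z with
    | zero => simp
    | add a b ha hb => simp only [map_add, TensorProduct.add_tmul, ha, hb]
    | tmul z w => simp

end StructureMapIdentities

/-! ### Twisted coproducts and associators. -/

namespace QuasiHopf

variable {k : Type*} [Field k] {A : Type*} [Ring A] [Algebra k A] (Q : QuasiHopf k A)

/-- This is quasi-coassociativity in the second factor of `t`, with the conjugation by `1 ⊗ Φ`
cleared of its inverse. The companion below is the same in the first factor. -/
lemma idIdComul_idComul_mul (t : A ⊗[k] A) :
    idIdComul k Q.comul (idComul k Q.comul t) * oneTensor₃ k A Q.assoc =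
      oneTensor₃ k A Q.assoc * idComulId k Q.comul (idComul k Q.comul t) := by
  induction t with
  | zero => simp
  | add a b ha hb => simp only [map_add, mul_add, add_mul, ha, hb]
  | tmul x y =>
    have h := Q.quasi_coassoc y
    simp [idIdComul, idComulId, idComul, oneTensor₃] at h ⊢
    rw [h]
    simp [mul_assoc]

lemma idComulId_comulId_mul (t : A ⊗[k] A) :
    idComulId k Q.comul (comulId k Q.comul t) * tensorOne₃ k A Q.assoc =
      tensorOne₃ k A Q.assoc * comulIdId k Q.comul (comulId k Q.comul t) := by
  induction t with
  | zero => simp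
  | add a b ha hb => simp only [map_add, mul_add, add_mul, ha, hb]
  | tmul x y =>
    rw [idComulId_comulId_tmul, comulIdId_comulId_tmul, Q.quasi_coassoc,
      ← appendRight_mul_tensorOne₃, ← tensorOne₃_mul_appendRight]
    simp [mul_assoc]

variable (J : (A ⊗[k] A)ˣ)

/-- The twisted coproduct `a ↦ J Δ(a) J⁻¹`, as an algebra homomorphism. -/
def twistComulHom : A →ₐ[k] A ⊗[k] A :=
  AlgHom.ofLinearMap (LinearMap.mulRight k (↑J⁻¹ : A ⊗[k] A) ∘ₗ
      LinearMap.mulLeft k (J : A ⊗[k] A) ∘ₗ Q.comul.toLinearMap)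
    (by simp) (by intro x y; simp [mul_assoc])

lemma twistComulHom_apply (a : A) :
    Q.twistComulHom J a = (J : A ⊗[k] A) * Q.comul a * (↑J⁻¹ : A ⊗[k] A) := rfl

/-- Here and in the four lemmas that follow, applying the twisted coproduct in one factor conjugates
by `J` in the two legs created by `Δ`. -/
lemma idComul_twist (t : A ⊗[k] A) :
    idComul k (Q.twistComulHom J) t =
      oneTensor₂ k A J * idComul k Q.comul t * oneTensor₂ k A (↑J⁻¹ : A ⊗[k] A) := by
  induction t with
  | zero => simp
  | add a b ha hb => simp only [map_add, mul_add, add_mul, ha, hb]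
  | tmul x y => simp [idComul, oneTensor₂, twistComulHom_apply]

lemma comulId_twist (t : A ⊗[k] A) :
    comulId k (Q.twistComulHom J) t =
      tensorOne₂ k A J * comulId k Q.comul t * tensorOne₂ k A (↑J⁻¹ : A ⊗[k] A) := by
  induction t with
  | zero => simp
  | add a b ha hb => simp only [map_add, mul_add, add_mul, ha, hb]
  | tmul x y =>
    simp only [tensorOne₂_eq_assoc, comulId, AlgHom.comp_apply, AlgEquiv.toAlgHom_apply,
      Algebra.TensorProduct.map_tmul, twistComulHom_apply, ← map_mul,
      Algebra.TensorProduct.tmul_mul_tmul, one_mul, mul_one, AlgHom.id_apply]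

lemma idIdComul_twist (t : A ⊗[k] (A ⊗[k] A)) :
    idIdComul k (Q.twistComulHom J) t =
      oneTensor₃ k A (oneTensor₂ k A J) * idIdComul k Q.comul t *
        oneTensor₃ k A (oneTensor₂ k A (↑J⁻¹ : A ⊗[k] A)) := by
  induction t with
  | zero => simp
  | add a b ha hb => simp only [map_add, mul_add, add_mul, ha, hb]
  | tmul x y => simp [idIdComul, oneTensor₃, idComul_twist]

lemma idComulId_twist (t : A ⊗[k] (A ⊗[k] A)) :
    idComulId k (Q.twistComulHom J) t =
      oneTensor₃ k A (tensorOne₂ k A J) * idComulId k Q.comul t *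
        oneTensor₃ k A (tensorOne₂ k A (↑J⁻¹ : A ⊗[k] A)) := by
  induction t with
  | zero => simp
  | add a b ha hb => simp only [map_add, mul_add, add_mul, ha, hb]
  | tmul x y => simp [idComulId, oneTensor₃, comulId_twist]

lemma comulIdId_twist (t : A ⊗[k] (A ⊗[k] A)) :
    comulIdId k (Q.twistComulHom J) t =
      tensorOne₃ k A (tensorOne₂ k A J) * comulIdId k Q.comul t *
        tensorOne₃ k A (tensorOne₂ k A (↑J⁻¹ : A ⊗[k] A)) := by
  induction t with
  | zero => simp
  | add a b ha hb => simp only [map_add, mul_add, add_mul, ha, hb]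
  | tmul x y =>
    simp only [tensorOne₃_tensorOne₂, comulIdId, AlgHom.comp_apply, AlgEquiv.toAlgHom_apply,
      Algebra.TensorProduct.map_tmul, twistComulHom_apply, ← map_mul,
      Algebra.TensorProduct.tmul_mul_tmul, one_mul, mul_one, AlgHom.id_apply]

/-- The pentagon equation for the twisted coproduct and associator. -/
lemma pentagon_twist :
    idIdComul k (Q.twistComulHom J) (Q.twistAssoc J) *
        comulIdId k (Q.twistComulHom J) (Q.twistAssoc J) =
      oneTensor₃ k A (Q.twistAssoc J) *
        idComulId k (Q.twistComulHom J) (Q.twistAssoc J) * tensorOne₃ k A (Q.twistAssoc J) := by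
  -- The relations below carry a trailing factor `X` so that they rewrite inside fully
  -- right-associated words. The ingredients are cancellation of `J⁻¹ J` under various maps,
  -- commutation of `J` in legs 1, 2 with `J⁻¹` in legs 3, 4, quasi-coassociativity on either side,
  -- and the pentagon for `Φ`. Together they bring both sides to the same word.
  have hcancel : ∀ (n : A ⊗[k] A →ₐ[k] A ⊗[k] (A ⊗[k] (A ⊗[k] A))) (X), n (↑J⁻¹) * (n J * X) = X := by
    intro n X
    rw [← mul_assoc, ← map_mul, Units.inv_mul, map_one, one_mul]
  have c12 := fun X => hcancel ((tensorOne₃ k A).comp (tensorOne₂ k A)) X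
  have c34 := fun X => hcancel ((oneTensor₃ k A).comp (oneTensor₂ k A)) X
  have c23 := fun X => hcancel ((oneTensor₃ k A).comp (tensorOne₂ k A)) X
  have cm := fun X => hcancel ((comulIdId k Q.comul).comp (idComul k Q.comul)) X
  have cl := fun X => hcancel ((oneTensor₃ k A).comp (comulId k Q.comul)) X
  have cr := fun X => hcancel ((tensorOne₃ k A).comp (idComul k Q.comul)) X
  simp only [AlgHom.comp_apply] at c12 c34 c23 cm cl cr
  have hcomm : ∀ X, oneTensor₃ k A (oneTensor₂ k A ↑J⁻¹) *
      (tensorOne₃ k A (tensorOne₂ k A J) * X) = tensorOne₃ k A (tensorOne₂ k A J) *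
      (oneTensor₃ k A (oneTensor₂ k A ↑J⁻¹) * X) := by
    intro X
    rw [← mul_assoc, ← mul_assoc, (commute_tensorOne₃_oneTensor₃ _ _).eq]
  have hq1 : ∀ X, oneTensor₃ k A Q.assoc * (idComulId k Q.comul (idComul k Q.comul J) * X) =
      idIdComul k Q.comul (idComul k Q.comul J) * (oneTensor₃ k A Q.assoc * X) := by
    intro X
    rw [← mul_assoc, ← Q.idIdComul_idComul_mul, mul_assoc]
  have hq2 : ∀ X, idComulId k Q.comul (comulId k Q.comul ↑J⁻¹) * (tensorOne₃ k A Q.assoc * X) =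
      tensorOne₃ k A Q.assoc * (comulIdId k Q.comul (comulId k Q.comul ↑J⁻¹) * X) := by
    intro X
    rw [← mul_assoc, Q.idComulId_comulId_mul, mul_assoc]
  have hp : ∀ X, idIdComul k Q.comul Q.assoc * (comulIdId k Q.comul Q.assoc * X) =
      oneTensor₃ k A Q.assoc * (idComulId k Q.comul Q.assoc * (tensorOne₃ k A Q.assoc * X)) := by
    intro X
    rw [← mul_assoc, Q.pentagon, mul_assoc, mul_assoc]
  rw [idIdComul_twist, comulIdId_twist, idComulId_twist]
  simp only [twistAssoc, map_mul,
    idIdComul_oneTensor₂, idComulId_oneTensor₂, comulIdId_oneTensor₂, idIdComul_tensorOne₂,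
    idComulId_tensorOne₂, comulIdId_tensorOne₂, idIdComul_comulId, tensorOne₃_oneTensor₂,
    mul_assoc, c12, c34, c23, cm, cl, cr, hcomm, hq1, hq2, hp]

/-- Twisting by a product `F J` amounts to twisting by `J` and then by `F`. -/
lemma twistAssoc_mul (F : (A ⊗[k] A)ˣ) :
    Q.twistAssoc (F * J) * (tensorOne₂ k A F * comulId k (Q.twistComulHom J) F) =
      oneTensor₂ k A F * idComul k (Q.twistComulHom J) F * Q.twistAssoc J := by
  have hcancel : ∀ (J : (A ⊗[k] A)ˣ) (n : A ⊗[k] A →ₐ[k] A ⊗[k] (A ⊗[k] A)) (X),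
      n (↑J⁻¹) * (n J * X) = X := by
    intro J n X
    rw [← mul_assoc, ← map_mul, Units.inv_mul, map_one, one_mul]
  simp only [idComul_twist, comulId_twist, twistAssoc, mul_inv_rev, Units.val_mul, map_mul,
    mul_assoc, hcancel]

end QuasiHopf

/-! ### Splittings of filtrations. -/

namespace Filt

variable {k V W G G' : Type*} [Field k] [AddCommGroup V] [Module k V] [AddCommGroup W] [Module k W]
  [AddCommGroup G] [Module k G] [AddCommGroup G'] [Module k G']

/-- Linear sections of the leading term maps of a filtration, which identify `G` with
`⨁ₙ fil n / fil (n + 1)`. -/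
structure Splitting (P : Filt k V G) where
  sec : ℕ → G →ₗ[k] V
  sec_mem : ∀ n g, sec n g ∈ P.fil n
  sub_sec_sym : ∀ n, ∀ x ∈ P.fil n, x - sec n (P.sym n x) ∈ P.fil (n + 1)
  sec_sym_of_ne : ∀ m n, m ≠ n → ∀ x ∈ P.fil n, sec m (P.sym n x) = 0
  span_sym : Submodule.span k {g | ∃ n, ∃ x ∈ P.fil n, P.sym n x = g} = ⊤

/-- A `Filt` only requires `sym n` to kill `fil (n + 1)`; the converse, that nothing else in `fil n`
is killed, comes from the splitting. -/
lemma Splitting.mem_fil_succ {P : Filt k V G} (s : P.Splitting) {n : ℕ} {x : V}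
    (hx : x ∈ P.fil n) (h : P.sym n x = 0) : x ∈ P.fil (n + 1) := by
  simpa [h] using s.sub_sec_sym n x hx

/-- The sections are compatible with a filtered map and its leading part. -/
lemma Splitting.sub_sec_mem {P : Filt k V G} {P' : Filt k W G'} (s : P.Splitting)
    (s' : P'.Splitting) {d : V →ₗ[k] W} {d₀ : G →ₗ[k] G'} (h : Compat P P' 0 d d₀) (n : ℕ)
    (g : G) : d (s.sec n g) - s'.sec n (d₀ g) ∈ P'.fil (n + 1) := by
  have hg : g ∈ Submodule.span k {g | ∃ n, ∃ x ∈ P.fil n, P.sym n x = g} := by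
    rw [s.span_sym]; trivial
  -- By linearity `g` may be taken to be a leading term of some degree `m`. For `m ≠ n` both
  -- sections vanish; for `m = n` both terms approximate `d x` modulo `fil (n + 1)`.
  induction hg using Submodule.span_induction with
  | mem g hg =>
    obtain ⟨m, x, hx, rfl⟩ := hg
    obtain ⟨h1, h2⟩ := h m m rfl x hx
    rw [h2]
    by_cases hm : n = m
    · subst hm
      have h3 := (h (n + 1) (n + 1) rfl _ (s.sub_sec_sym n x hx)).1
      have h4 := s'.sub_sec_sym n (d x) h1
      rw [map_sub] at h3
      have := sub_mem h4 h3
      rwa [sub_sub_sub_cancel_left] at this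
    · rw [s.sec_sym_of_ne n m hm x hx, s'.sec_sym_of_ne n m hm _ h1]
      simp
  | zero => simp
  | add a b _ _ ha hb =>
    have := add_mem ha hb
    simp only [map_add]
    rwa [add_sub_add_comm]
  | smul c a _ ha =>
    simp only [map_smul, ← smul_sub]
    exact Submodule.smul_mem _ _ ha

/-- Sections kill leading terms of every other degree, above or below, so unlike in `sum_sym_tmul`
no bound on `n` is needed. -/
lemma sum_sec_tmul {P : Filt k V G} {P' : Filt k W G'} (s : P.Splitting) (s' : P'.Splitting)
    {i j : ℕ} (n : ℕ) {x : V} (hx : x ∈ P.fil i) {y : W} (hy : y ∈ P'.fil j) :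
    (∑ p ∈ Finset.HasAntidiagonal.antidiagonal n, TensorProduct.map (s.sec p.1) (s'.sec p.2))
        (P.sym i x ⊗ₜ[k] P'.sym j y) =
      if n = i + j then s.sec i (P.sym i x) ⊗ₜ[k] s'.sec j (P'.sym j y) else 0 := by
  rw [LinearMap.sum_apply]
  have key : ∀ p ∈ Finset.HasAntidiagonal.antidiagonal n, p ≠ (i, j) →
      TensorProduct.map (s.sec p.1) (s'.sec p.2) (P.sym i x ⊗ₜ[k] P'.sym j y) = 0 := by
    rintro ⟨a, b⟩ - hne
    rw [TensorProduct.map_tmul]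
    by_cases ha : a = i
    · have hb : b ≠ j := by
        rintro rfl
        exact hne (by rw [ha])
      rw [s'.sec_sym_of_ne b j hb y hy, TensorProduct.tmul_zero]
    · rw [s.sec_sym_of_ne a i ha x hx, TensorProduct.zero_tmul]
  split_ifs with hn
  · rw [Finset.sum_eq_single (i, j) key]
    · rfl
    · intro hm
      exact absurd (Finset.HasAntidiagonal.mem_antidiagonal.2 hn.symm) hm
  · refine Finset.sum_eq_zero fun p hp => key p hp ?_
    rintro rfl
    exact hn (Finset.HasAntidiagonal.mem_antidiagonal.1 hp).symm

/-- The splitting of a tensor product of filtrations. -/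
def Splitting.tensor {P : Filt k V G} {P' : Filt k W G'} (s : P.Splitting) (s' : P'.Splitting) :
    (P.tensor P').Splitting where
  sec n := ∑ p ∈ Finset.HasAntidiagonal.antidiagonal n, TensorProduct.map (s.sec p.1) (s'.sec p.2)
  sec_mem n g := by
    rw [LinearMap.sum_apply]
    refine Submodule.sum_mem _ fun p hp => ?_
    induction g with
    | zero => simp
    | add a b ha hb => rw [map_add]; exact add_mem ha hb
    | tmul a b =>
      exact tmul_mem P P' (Finset.HasAntidiagonal.mem_antidiagonal.1 hp).symm (s.sec_mem _ _)
        (s'.sec_mem _ _)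
  sub_sec_sym n t ht := by
    induction ht using Submodule.span_induction with
    | mem t ht =>
      obtain ⟨i, j, hij, x, hx, y, hy, rfl⟩ := ht
      rw [sym_tmul P P' hij.symm hx hy, sum_sec_tmul s s' n hx hy, if_pos hij.symm]
      -- Replacing one tensor factor at a time leaves two error terms, each one degree deeper.
      have e : x ⊗ₜ[k] y - s.sec i (P.sym i x) ⊗ₜ[k] s'.sec j (P'.sym j y) =
          (x - s.sec i (P.sym i x)) ⊗ₜ[k] y +
            s.sec i (P.sym i x) ⊗ₜ[k] (y - s'.sec j (P'.sym j y)) := by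
        rw [TensorProduct.sub_tmul, TensorProduct.tmul_sub]
        abel
      rw [e]
      exact add_mem (tmul_mem P P' (by omega) (s.sub_sec_sym i x hx) hy)
        (tmul_mem P P' (by omega) (s.sec_mem i _) (s'.sub_sec_sym j y hy))
    | zero => simp
    | add a b _ _ ha hb =>
      have := add_mem ha hb
      rwa [sub_add_sub_comm, ← map_add, ← map_add] at this
    | smul c a _ ha =>
      rw [map_smul, map_smul, ← smul_sub]
      exact Submodule.smul_mem _ _ ha
  sec_sym_of_ne m n hmn t ht := by
    induction ht using Submodule.span_induction with
    | mem t ht =>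
      obtain ⟨i, j, hij, x, hx, y, hy, rfl⟩ := ht
      rw [sym_tmul P P' hij.symm hx hy, sum_sec_tmul s s' m hx hy, if_neg (by omega)]
    | zero => simp
    | add a b _ _ ha hb => rw [map_add, map_add, ha, hb, add_zero]
    | smul c a _ ha => rw [map_smul, map_smul, ha, smul_zero]
  span_sym := by
    refine Submodule.eq_top_iff'.2 fun t => ?_
    have h : ∀ a ∈ Submodule.span k {g | ∃ n, ∃ x ∈ P.fil n, P.sym n x = g},
        ∀ b ∈ Submodule.span k {g | ∃ n, ∃ x ∈ P'.fil n, P'.sym n x = g},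
        a ⊗ₜ[k] b ∈ Submodule.span k
          {g | ∃ n, ∃ x ∈ (P.tensor P').fil n, (P.tensor P').sym n x = g} := by
      intro a ha b hb
      have := Submodule.apply_mem_map₂ (TensorProduct.mk k G G') ha hb
      rw [Submodule.map₂_span_span] at this
      refine Submodule.span_mono ?_ this
      rintro _ ⟨_, ⟨i, x, hx, rfl⟩, _, ⟨j, y, hy, rfl⟩, rfl⟩
      exact ⟨i + j, x ⊗ₜ y, tmul_mem P P' rfl hx hy, sym_tmul P P' rfl hx hy⟩
    induction t with
    | zero => exact zero_mem _
    | add a b ha hb => exact add_mem ha hb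
    | tmul x y =>
      exact h x (by rw [s.span_sym]; trivial) y (by rw [s'.span_sym]; trivial)

/-- If `i + j = m + n`, then `i ≥ m` or `j ≥ n`. -/
lemma tensor_eq_bot {P : Filt k V G} {P' : Filt k W G'} {m n : ℕ} (h : P.fil m = ⊥)
    (h' : P'.fil n = ⊥) : (P.tensor P').fil (m + n) = ⊥ := by
  refine Submodule.span_eq_bot.2 ?_
  rintro _ ⟨i, j, hij, x, hx, y, hy, rfl⟩
  rcases le_or_gt m i with hi | hi
  · have := P.anti hi hx
    rw [h, Submodule.mem_bot] at this
    rw [this, TensorProduct.zero_tmul]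
  · have := P'.anti (show n ≤ j by omega) hy
    rw [h', Submodule.mem_bot] at this
    rw [this, TensorProduct.tmul_zero]

/-! ### The elements `1 + fil n` of a multiplicative filtration. -/

section Mult

variable {A B : Type*} [Ring A] [Algebra k A] [Ring B] [Algebra k B] {P : Filt k A B}

lemma IsMult.pow_mem (h : P.IsMult) {x : A} {m : ℕ} (hx : x ∈ P.fil m) (n : ℕ) :
    x ^ n ∈ P.fil (m * n) := by
  induction n with
  | zero => exact h.mem _
  | succ n ih => rw [pow_succ]; exact (h.mul (m * n) m _ (by ring) _ ih _ hx).1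

/-- An element of `fil 1` is nilpotent once the filtration reaches zero. -/
lemma IsMult.isUnit_one_add (h : P.IsMult) {N : ℕ} (hN : P.fil N = ⊥) {x : A}
    (hx : x ∈ P.fil 1) : IsUnit (1 + x) := by
  refine IsNilpotent.isUnit_one_add ⟨N, ?_⟩
  have := h.pow_mem hx N
  rwa [one_mul, hN, Submodule.mem_bot] at this

/-- `1 + fil n` is closed under products. -/
lemma IsMult.mul_sub_one_mem (h : P.IsMult) {n : ℕ} {x y : A} (hx : x - 1 ∈ P.fil n)
    (hy : y - 1 ∈ P.fil n) : x * y - 1 ∈ P.fil n := by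
  have e : x * y - 1 = x * (y - 1) + (x - 1) := by noncomm_ring
  rw [e]
  exact add_mem (h.mul 0 n n (zero_add n).symm _ (h.mem x) _ hy).1 hx

/-- The error is the cross term `(x - 1) (y - 1)` in `fil (2n)`, and `2n ≥ n + 1` because `n ≥ 1`.
-/
lemma IsMult.mul_sub_one_sub_mem (h : P.IsMult) {n : ℕ} (hn : 1 ≤ n) {x y : A}
    (hx : x - 1 ∈ P.fil n) (hy : y - 1 ∈ P.fil n) :
    (x * y - 1) - ((x - 1) + (y - 1)) ∈ P.fil (n + 1) := by
  have e : (x * y - 1) - ((x - 1) + (y - 1)) = (x - 1) * (y - 1) := by noncomm_ring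
  rw [e]
  exact P.anti (by omega) (h.mul n n _ rfl _ hx _ hy).1

/-- On `1 + fil n` the map `x ↦ sym n (x - 1)` acts as a logarithm; it turns multiplicative
identities such as the pentagon into linear ones. -/
lemma IsMult.sym_mul_sub_one (h : P.IsMult) {n : ℕ} (hn : 1 ≤ n) {x y : A}
    (hx : x - 1 ∈ P.fil n) (hy : y - 1 ∈ P.fil n) :
    P.sym n (x * y - 1) = P.sym n (x - 1) + P.sym n (y - 1) := by
  have := P.sym_succ n _ (h.mul_sub_one_sub_mem hn hx hy)
  rwa [map_sub, map_add, sub_eq_zero] at this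

end Mult

end Filt

/-! ### The splitting of the filtration by powers of an ideal. -/

namespace Gr

variable {k : Type*} [Field k] {A : Type*} [Ring A] [Algebra k A] (I : Ideal A)

lemma exists_mkQ_section (k : Type*) [Field k] [Algebra k A] (n : ℕ) :
    ∃ r : ((powSub k I n) ⧸ (powSub k I (n + 1)).submoduleOf (powSub k I n)) →ₗ[k] powSub k I n,
      (Submodule.mkQ ((powSub k I (n + 1)).submoduleOf (powSub k I n))) ∘ₗ r = LinearMap.id :=
  LinearMap.exists_rightInverse_of_surjective _ (Submodule.range_mkQ _)

/-- A section of the projection `Iⁿ → Iⁿ / Iⁿ⁺¹`, extended by zero to `gr(A)`. -/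
def sec (k : Type*) [Field k] [Algebra k A] (n : ℕ) : Gr k I →ₗ[k] A :=
  (powSub k I n).subtype ∘ₗ (exists_mkQ_section I k n).choose ∘ₗ
    DirectSum.component k ℕ
      (fun n => (powSub k I n) ⧸ (powSub k I (n + 1)).submoduleOf (powSub k I n)) n

lemma sec_mem (n : ℕ) (g : Gr k I) : sec I k n g ∈ powSub k I n :=
  Subtype.mem _

lemma sub_sec_cls {n : ℕ} (x : powSub k I n) :
    (x : A) - sec I k n (cls k I n x) ∈ powSub k I (n + 1) := by
  have h1 : sec I k n (cls k I n x) =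
      ((exists_mkQ_section I k n).choose (Submodule.mkQ _ x) : powSub k I n) := by
    have := DirectSum.component.lof_self k
      (M := fun n => (powSub k I n) ⧸ (powSub k I (n + 1)).submoduleOf (powSub k I n)) n
      (Submodule.mkQ _ x)
    exact congrArg (fun q => ((exists_mkQ_section I k n).choose q : A)) this
  have h2 := LinearMap.congr_fun (exists_mkQ_section I k n).choose_spec (Submodule.mkQ _ x)
  rw [LinearMap.comp_apply, LinearMap.id_apply] at h2
  rw [h1]
  have h3 := (Submodule.Quotient.eq _).1 h2.symm
  exact h3

lemma sec_cls_of_ne {m n : ℕ} (h : m ≠ n) (x : powSub k I n) :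
    sec I k m (cls k I n x) = 0 := by
  have := DirectSum.component.of (R := k)
      (M := fun n => (powSub k I n) ⧸ (powSub k I (n + 1)).submoduleOf (powSub k I n))
      m n (Submodule.mkQ ((powSub k I (n + 1)).submoduleOf (powSub k I n)) x)
  rw [dif_neg h.symm] at this
  refine (congrArg (fun q => ((exists_mkQ_section I k m).choose q : A)) this).trans ?_
  simp

/-- The splitting of the filtration of `A` by the powers of `I`. -/
def splitting (k : Type*) [Field k] [Algebra k A] : (filt k I).Splitting where
  sec := sec I k
  sec_mem := sec_mem I
  sub_sec_sym n x hx := by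
    rw [filt_sym ⟨x, hx⟩]
    exact sub_sec_cls I ⟨x, hx⟩
  sec_sym_of_ne m n h x hx := by
    rw [filt_sym ⟨x, hx⟩]
    exact sec_cls_of_ne I h ⟨x, hx⟩
  span_sym := by
    refine Submodule.eq_top_iff'.2 fun g => ?_
    induction g using Gr.induction with
    | h0 => exact zero_mem _
    | hadd a b ha hb => exact add_mem ha hb
    | hcls n x => exact Submodule.subset_span ⟨n, x, x.2, filt_sym x⟩

variable {I} in
lemma finiteDimensional [FiniteDimensional k A] {N : ℕ} (hN : powSub k I N = ⊥) :
    FiniteDimensional k (Gr k I) := by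
  -- Only degrees below `N` contribute, so the leading term maps give a surjection from `N` copies
  -- of `A`.
  refine Module.Finite.of_surjective
    (∑ i : Fin N, (filt k I).sym i ∘ₗ LinearMap.proj (R := k) (φ := fun _ : Fin N => A) i) ?_
  rw [← LinearMap.range_eq_top, Submodule.eq_top_iff']
  intro g
  induction g using Gr.induction with
  | h0 => exact zero_mem _
  | hadd a b ha hb => exact add_mem ha hb
  | hcls n x =>
    by_cases hn : n < N
    · refine ⟨Pi.single ⟨n, hn⟩ (x : A), ?_⟩
      rw [LinearMap.sum_apply, Finset.sum_eq_single ⟨n, hn⟩]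
      · simp [filt_sym]
      · intro j _ hj
        simp [Pi.single_eq_of_ne hj]
      · simp
    · have : (x : A) = 0 := by
        have := powSub_anti (not_lt.1 hn) x.2
        rwa [hN, Submodule.mem_bot] at this
      rw [show x = 0 from Subtype.ext this, map_zero]
      exact zero_mem _

end Gr

/-! ### Duality between the cobar complex of `H` and the Hochschild complex of `H*`. -/

section DualCochains

variable {k : Type*} [Field k]

/-- The tensor product of two linear forms, as a linear form. -/
def formMul {V W : Type*} [AddCommGroup V] [Module k V] [AddCommGroup W] [Module k W]
    (f : V →ₗ[k] k) (g : W →ₗ[k] k) : V ⊗[k] W →ₗ[k] k :=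
  LinearMap.mul' k k ∘ₗ TensorProduct.map f g

@[simp] lemma formMul_tmul {V W : Type*} [AddCommGroup V] [Module k V] [AddCommGroup W]
    [Module k W] (f : V →ₗ[k] k) (g : W →ₗ[k] k) (v : V) (w : W) :
    formMul f g (v ⊗ₜ w) = f v * g w := rfl

/-- Linear forms `a ⊗ b ⊗ c` separate the points of `H ⊗ H ⊗ H`. -/
lemma eq_of_formMul_eq {H : Type*} [AddCommGroup H] [Module k H] {s t : H ⊗[k] (H ⊗[k] H)}
    (h : ∀ a b c : H →ₗ[k] k, formMul a (formMul b c) s = formMul a (formMul b c) t) : s = t := by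
  set b := Module.Basis.ofVectorSpace k H
  refine (b.tensorProduct (b.tensorProduct b)).ext_elem ?_
  rintro ⟨i, j, l⟩
  have key : ∀ u, (b.tensorProduct (b.tensorProduct b)).repr u (i, j, l) =
      formMul (b.coord i) (formMul (b.coord j) (b.coord l)) u := by
    intro u
    induction u with
    | zero => simp
    | add x y hx hy => rw [map_add, Finsupp.add_apply, hx, hy, map_add]
    | tmul x u =>
      induction u with
      | zero => simp
      | add y z hy hz =>
        rw [TensorProduct.tmul_add, map_add, Finsupp.add_apply, hy, hz, map_add]
      | tmul y z =>
        rw [Module.Basis.tensorProduct_repr_tmul_apply, Module.Basis.tensorProduct_repr_tmul_apply,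
          formMul_tmul, formMul_tmul]
        simp [mul_comm]
  rw [key, key, h]

/-- Bilinear forms on the dual of a finite dimensional space `H` are elements of `H ⊗ H`. -/
lemma exists_formMul_eq {H : Type*} [AddCommGroup H] [Module k H] [FiniteDimensional k H]
    (j : (H →ₗ[k] k) →ₗ[k] (H →ₗ[k] k) →ₗ[k] k) :
    ∃ t : H ⊗[k] H, ∀ a b, formMul a b t = j a b := by
  set b := Module.finBasis k H
  -- The coefficients are the values of `j` on the dual basis.
  refine ⟨∑ i, ∑ l, j (b.coord i) (b.coord l) • (b i ⊗ₜ[k] b l), fun f g => ?_⟩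
  conv_rhs => rw [← b.sum_dual_apply_smul_coord f, ← b.sum_dual_apply_smul_coord g]
  simp only [map_sum, map_smul, LinearMap.sum_apply, LinearMap.smul_apply, formMul_tmul,
    smul_eq_mul, Finset.mul_sum]
  rw [Finset.sum_comm]
  refine Finset.sum_congr rfl fun i _ => Finset.sum_congr rfl fun l _ => ?_
  ring

variable {H : Type*} [Ring H] [Bialgebra k H]

local notation "Δ" => Bialgebra.comulAlgHom k H

/-- The transpose of `Δ` is the convolution product. In the lemmas below, each `Δ` in a coface map
therefore becomes a product of adjacent arguments, and each inserted `1` becomes the augmentation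
`dualAug` of an outer argument: these are the terms of the Hochschild differential. -/
lemma formMul_comul (a b : WithConv (H →ₗ[k] k)) (x : H) :
    formMul a.ofConv b.ofConv (Δ x) = (a * b).ofConv x := by
  rw [LinearMap.convMul_apply]
  rfl

lemma formMul_idComul (a b c : WithConv (H →ₗ[k] k)) (t : H ⊗[k] H) :
    formMul a.ofConv (formMul b.ofConv c.ofConv) (idComul k Δ t) =
      formMul a.ofConv (b * c).ofConv t := by
  induction t with
  | zero => simp
  | add x y hx hy => simp only [map_add, hx, hy]
  | tmul x y => simp only [idComul, Algebra.TensorProduct.map_tmul, AlgHom.id_apply, formMul_tmul,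
      formMul_comul]

/-- The last factor `W` is left general because both `H` and `H ⊗ H` occur there. -/
lemma formMul_assoc {W : Type*} [AddCommGroup W] [Module k W] (a b : H →ₗ[k] k)
    (c : W →ₗ[k] k) (t : H ⊗[k] H) (w : W) :
    formMul a (formMul b c) (TensorProduct.assoc k H H W (t ⊗ₜ w)) = formMul a b t * c w := by
  induction t with
  | zero => simp
  | add x y hx hy => simp only [TensorProduct.add_tmul, map_add, add_mul, hx, hy]
  | tmul x y => simp [mul_assoc]

lemma formMul_comulId (a b c : WithConv (H →ₗ[k] k)) (t : H ⊗[k] H) :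
    formMul a.ofConv (formMul b.ofConv c.ofConv) (comulId k Δ t) =
      formMul (a * b).ofConv c.ofConv t := by
  induction t with
  | zero => simp
  | add x y hx hy => simp only [map_add, hx, hy]
  | tmul x y =>
    refine (formMul_assoc _ _ _ _ _).trans ?_
    exact congrArg (· * _) (formMul_comul a b x)

lemma formMul_oneTensor₂ (a b c : WithConv (H →ₗ[k] k)) (t : H ⊗[k] H) :
    formMul a.ofConv (formMul b.ofConv c.ofConv) (oneTensor₂ k H t) =
      dualAug k H a * formMul b.ofConv c.ofConv t := rfl

lemma formMul_tensorOne₂ (a b c : WithConv (H →ₗ[k] k)) (t : H ⊗[k] H) :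
    formMul a.ofConv (formMul b.ofConv c.ofConv) (tensorOne₂ k H t) =
      formMul a.ofConv b.ofConv t * dualAug k H c := by
  rw [tensorOne₂_eq_assoc]
  exact formMul_assoc _ _ _ _ _

lemma formMul_idIdComul (a b c d : WithConv (H →ₗ[k] k)) (t : H ⊗[k] (H ⊗[k] H)) :
    formMul a.ofConv (formMul b.ofConv (formMul c.ofConv d.ofConv)) (idIdComul k Δ t) =
      formMul a.ofConv (formMul b.ofConv (c * d).ofConv) t := by
  induction t with
  | zero => simp
  | add x y hx hy => simp only [map_add, hx, hy]
  | tmul x y => simp only [idIdComul, Algebra.TensorProduct.map_tmul, AlgHom.id_apply,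
      formMul_tmul, formMul_idComul]

lemma formMul_idComulId (a b c d : WithConv (H →ₗ[k] k)) (t : H ⊗[k] (H ⊗[k] H)) :
    formMul a.ofConv (formMul b.ofConv (formMul c.ofConv d.ofConv)) (idComulId k Δ t) =
      formMul a.ofConv (formMul (b * c).ofConv d.ofConv) t := by
  induction t with
  | zero => simp
  | add x y hx hy => simp only [map_add, hx, hy]
  | tmul x y => simp only [idComulId, Algebra.TensorProduct.map_tmul, AlgHom.id_apply,
      formMul_tmul, formMul_comulId]

lemma formMul_comulIdId (a b c d : WithConv (H →ₗ[k] k)) (t : H ⊗[k] (H ⊗[k] H)) :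
    formMul a.ofConv (formMul b.ofConv (formMul c.ofConv d.ofConv)) (comulIdId k Δ t) =
      formMul (a * b).ofConv (formMul c.ofConv d.ofConv) t := by
  induction t with
  | zero => simp
  | add x y hx hy => simp only [map_add, hx, hy]
  | tmul x y =>
    refine (formMul_assoc _ _ _ _ _).trans ?_
    exact congrArg (· * _) (formMul_comul a b x)

lemma formMul_oneTensor₃ (a b c d : WithConv (H →ₗ[k] k)) (t : H ⊗[k] (H ⊗[k] H)) :
    formMul a.ofConv (formMul b.ofConv (formMul c.ofConv d.ofConv)) (oneTensor₃ k H t) =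
      dualAug k H a * formMul b.ofConv (formMul c.ofConv d.ofConv) t := rfl

lemma formMul_tensorOne₃ (a b c d : WithConv (H →ₗ[k] k)) (t : H ⊗[k] (H ⊗[k] H)) :
    formMul a.ofConv (formMul b.ofConv (formMul c.ofConv d.ofConv)) (tensorOne₃ k H t) =
      formMul a.ofConv (formMul b.ofConv c.ofConv) t * dualAug k H d := by
  induction t with
  | zero => simp
  | add x y hx hy => simp only [map_add, add_mul, hx, hy]
  | tmul x y => simp only [tensorOne₃, Algebra.TensorProduct.map_tmul, AlgHom.id_apply,
      formMul_tmul, formMul_tensorOne₂, mul_assoc]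

/-- An element of `H ⊗ H ⊗ H` as a trilinear form on `H*`. -/
def trilinear (t : H ⊗[k] (H ⊗[k] H)) :
    WithConv (H →ₗ[k] k) →ₗ[k] WithConv (H →ₗ[k] k) →ₗ[k] WithConv (H →ₗ[k] k) →ₗ[k] k :=
  LinearMap.mk₂ k
    (fun a b =>
      { toFun := fun c => formMul a.ofConv (formMul b.ofConv c.ofConv) t
        map_add' := fun c c' => by
          simp [formMul, TensorProduct.map_add_right, LinearMap.comp_add]
        map_smul' := fun r c => by
          simp [formMul, TensorProduct.map_smul_right, LinearMap.comp_smul] })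
    (fun a a' b => by ext c; simp [formMul, TensorProduct.map_add_left, LinearMap.comp_add])
    (fun r a b => by ext c; simp [formMul, TensorProduct.map_smul_left, LinearMap.comp_smul])
    (fun a b b' => by
      ext c
      simp [formMul, TensorProduct.map_add_left, TensorProduct.map_add_right, LinearMap.comp_add])
    (fun r a b => by
      ext c
      simp [formMul, TensorProduct.map_smul_left, TensorProduct.map_smul_right,
        LinearMap.comp_smul])

lemma trilinear_apply (t : H ⊗[k] (H ⊗[k] H)) (a b c : WithConv (H →ₗ[k] k)) :
    trilinear t a b c = formMul a.ofConv (formMul b.ofConv c.ofConv) t := rfl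

/-- If `H³(H*, k) = 0`, then a solution `t` of the linearised pentagon equation is a
coboundary. -/
lemma exists_eq_coboundary [FiniteDimensional k H] (hH : Subsingleton (H3 (dualAug k H)))
    (t : H ⊗[k] (H ⊗[k] H))
    (ht : idIdComul k Δ t + comulIdId k Δ t =
      oneTensor₃ k H t + idComulId k Δ t + tensorOne₃ k H t) :
    ∃ j : H ⊗[k] H,
      t = oneTensor₂ k H j - comulId k Δ j + idComul k Δ j - tensorOne₂ k H j := by
  rw [subsingleton_H3_iff] at hH
  obtain ⟨j, hj⟩ := hH (show trilinear t ∈ Z3 (dualAug k H) by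
    intro a b c d
    have h := congrArg
      (formMul a.ofConv (formMul b.ofConv (formMul c.ofConv d.ofConv))) ht
    simp only [map_add, formMul_idIdComul, formMul_comulIdId, formMul_oneTensor₃,
      formMul_idComulId, formMul_tensorOne₃] at h
    simp only [trilinear_apply]
    linear_combination -h)
  set e := WithConv.linearEquiv k (H →ₗ[k] k)
  -- A Hochschild 2-cochain on `H*` is an element of `H ⊗ H` by finite dimensionality; pairing with
  -- all forms then recovers the identity in `H ⊗ H ⊗ H`.
  obtain ⟨s, hs⟩ := exists_formMul_eq (j.compl₁₂ e.symm.toLinearMap e.symm.toLinearMap)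
  have hs' : ∀ a b : WithConv (H →ₗ[k] k), formMul a.ofConv b.ofConv s = j a b :=
    fun a b => hs a.ofConv b.ofConv
  refine ⟨s, eq_of_formMul_eq fun a b c => ?_⟩
  have h := hj (WithConv.toConv a) (WithConv.toConv b) (WithConv.toConv c)
  simp only [← hs', trilinear_apply] at h
  rw [map_sub, map_add, map_sub]
  have h1 := formMul_oneTensor₂ (WithConv.toConv a) (WithConv.toConv b) (WithConv.toConv c) s
  have h2 := formMul_comulId (WithConv.toConv a) (WithConv.toConv b) (WithConv.toConv c) s
  have h3 := formMul_idComul (WithConv.toConv a) (WithConv.toConv b) (WithConv.toConv c) s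
  have h4 := formMul_tensorOne₂ (WithConv.toConv a) (WithConv.toConv b) (WithConv.toConv c) s
  simp only at h h1 h2 h3 h4
  linear_combination h - h1 + h2 - h3 + h4

end DualCochains

/-! ### Filtered maps on elements close to `1`. -/

namespace Filt

variable {k V W G G' : Type*} [Field k] [AddCommGroup V] [Module k V] [AddCommGroup W] [Module k W]
  [AddCommGroup G] [Module k G] [AddCommGroup G'] [Module k G']

lemma Compat.add {P : Filt k V G} {P' : Filt k W G'} {d : ℕ} {f g : V →ₗ[k] W}
    {f₀ g₀ : G →ₗ[k] G'} (hf : Compat P P' d f f₀) (hg : Compat P P' d g g₀) :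
    Compat P P' d (f + g : V →ₗ[k] W) (f₀ + g₀ : G →ₗ[k] G') := by
  intro n m hm x hx
  obtain ⟨h1, h2⟩ := hf n m hm x hx
  obtain ⟨h3, h4⟩ := hg n m hm x hx
  exact ⟨add_mem h1 h3, by simp only [LinearMap.add_apply, h2, h4, map_add]⟩

lemma Compat.sub {P : Filt k V G} {P' : Filt k W G'} {d : ℕ} {f g : V →ₗ[k] W}
    {f₀ g₀ : G →ₗ[k] G'} (hf : Compat P P' d f f₀) (hg : Compat P P' d g g₀) :
    Compat P P' d (f - g : V →ₗ[k] W) (f₀ - g₀ : G →ₗ[k] G') := by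
  intro n m hm x hx
  obtain ⟨h1, h2⟩ := hf n m hm x hx
  obtain ⟨h3, h4⟩ := hg n m hm x hx
  exact ⟨sub_mem h1 h3, by simp only [LinearMap.sub_apply, h2, h4, map_sub]⟩

lemma Compat.map_sub_one {A B A' B' : Type*} [Ring A] [Algebra k A] [Ring B] [Algebra k B]
    [Ring A'] [Algebra k A'] [Ring B'] [Algebra k B'] {P : Filt k A B} {P' : Filt k A' B'}
    {f : A →ₐ[k] A'} {f₀ : B →ₐ[k] B'} (h : Compat P P' 0 f f₀) {n : ℕ} {x : A}
    (hx : x - 1 ∈ P.fil n) :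
    f x - 1 ∈ P'.fil n ∧ P'.sym n (f x - 1) = f₀ (P.sym n (x - 1)) := by
  have := h n n rfl _ hx
  rw [map_sub, map_one] at this
  exact ⟨this.1, this.2.symm⟩

lemma IsMult.sub_one_mem_of_sym_zero {A B : Type*} [Ring A] [Algebra k A] [Ring B] [Algebra k B]
    {P : Filt k A B} (h : P.IsMult) (s : P.Splitting) {x : A} (hx : P.sym 0 x = 1) :
    x - 1 ∈ P.fil 1 :=
  s.mem_fil_succ (h.mem _) (by rw [map_sub, hx, h.one, sub_self])

lemma IsMult.sym_zero_eq_one {A B : Type*} [Ring A] [Algebra k A] [Ring B] [Algebra k B]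
    {P : Filt k A B} (h : P.IsMult) {x : A} (hx : x - 1 ∈ P.fil 1) : P.sym 0 x = 1 := by
  have := P.sym_succ 0 _ hx
  rwa [map_sub, h.one, sub_eq_zero] at this

end Filt

/-! ### Removing the associator degree by degree. -/

namespace QuasiHopf

open Filt

variable {k : Type*} [Field k] {A : Type*} [Ring A] [Algebra k A] {Q : QuasiHopf k A}
  {I : Ideal A} [I.IsTwoSided]

/-- Twisting by an element of `1 + fil 1` does not change the leading part of the coproduct. -/
lemma IsQuasiHopfIdeal.twistComul_compat (h : Q.IsQuasiHopfIdeal I) {J : (A ⊗[k] A)ˣ}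
    (hJ : (J : A ⊗[k] A) - 1 ∈ ((Gr.filt k I).tensor (Gr.filt k I)).fil 1) :
    Compat (Gr.filt k I) ((Gr.filt k I).tensor (Gr.filt k I)) 0 (Q.twistComulHom J)
      h.grComul := by
  have hM : ((Gr.filt k I).tensor (Gr.filt k I)).IsMult := Gr.filt_isMult.tensor Gr.filt_isMult
  have h1 := hM.sym_zero_eq_one hJ
  -- Taking degree `0` leading terms is multiplicative, so `J⁻¹` has leading term `1` as well.
  have h2 : ((Gr.filt k I).tensor (Gr.filt k I)).sym 0 (↑J⁻¹ : A ⊗[k] A) = 1 := by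
    have := map_mul hM.sym₀ (J : A ⊗[k] A) (↑J⁻¹ : A ⊗[k] A)
    rw [Units.mul_inv, map_one] at this
    change 1 = ((Gr.filt k I).tensor (Gr.filt k I)).sym 0 (J : A ⊗[k] A) *
      ((Gr.filt k I).tensor (Gr.filt k I)).sym 0 (↑J⁻¹ : A ⊗[k] A) at this
    rw [h1, one_mul] at this
    exact this.symm
  have h3 := (hM.compat_mulRight (↑J⁻¹ : A ⊗[k] A)).comp
    ((hM.compat_mulLeft (J : A ⊗[k] A)).comp h.grComul_compat)
  rw [h1, h2] at h3
  intro n m hm x hx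
  obtain ⟨h4, h5⟩ := h3 n m (by omega) x hx
  refine ⟨h4, Eq.trans ?_ h5⟩
  simp

variable [FiniteDimensional k A]

/-- If the twisted associator is `1` modulo terms of degree `n ≥ 1`, then a further twist by an
element of `1 + fil n` makes it `1` modulo terms of degree `n + 1`. -/
lemma exists_twistAssoc_step (h : Q.IsQuasiHopfIdeal I) {N : ℕ} (hN : powSub k I N = ⊥)
    (hgr : (Q.gr I h).IsHopf) (hH : Subsingleton ((Q.gr I h).DualH3 hgr)) {n : ℕ} (hn : 1 ≤ n)
    {J : (A ⊗[k] A)ˣ}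
    (hJ : (J : A ⊗[k] A) - 1 ∈ ((Gr.filt k I).tensor (Gr.filt k I)).fil 1)
    (hΦ : Q.twistAssoc J - 1 ∈
      ((Gr.filt k I).tensor ((Gr.filt k I).tensor (Gr.filt k I))).fil n) :
    ∃ F : (A ⊗[k] A)ˣ,
      (F : A ⊗[k] A) - 1 ∈ ((Gr.filt k I).tensor (Gr.filt k I)).fil n ∧
      Q.twistAssoc (F * J) - 1 ∈
        ((Gr.filt k I).tensor ((Gr.filt k I).tensor (Gr.filt k I))).fil (n + 1) := by
  set P := Gr.filt k I with hP
  have hM : P.IsMult := Gr.filt_isMult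
  have hM2 : (P.tensor P).IsMult := hM.tensor hM
  have hM3 : (P.tensor (P.tensor P)).IsMult := filt_isMult₃ I
  have hM4 : (P.tensor (P.tensor (P.tensor P))).IsMult := filt_isMult₄ I
  let s := Gr.splitting I k
  let s2 := s.tensor s
  let s3 := s.tensor s2
  have hD := h.twistComul_compat hJ
  set D := Q.twistComulHom J
  set Ψ := Q.twistAssoc J
  -- the leading term of `Ψ` solves the linearised pentagon equation
  have hlin : idIdComul k h.grComul ((P.tensor (P.tensor P)).sym n (Ψ - 1)) +
      comulIdId k h.grComul ((P.tensor (P.tensor P)).sym n (Ψ - 1)) =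
      oneTensor₃ k (Gr k I) ((P.tensor (P.tensor P)).sym n (Ψ - 1)) +
        idComulId k h.grComul ((P.tensor (P.tensor P)).sym n (Ψ - 1)) +
        tensorOne₃ k (Gr k I) ((P.tensor (P.tensor P)).sym n (Ψ - 1)) := by
    obtain ⟨a1, b1⟩ := (compat_idIdComul hD).map_sub_one hΦ
    obtain ⟨a2, b2⟩ := (compat_comulIdId hD).map_sub_one hΦ
    obtain ⟨a3, b3⟩ := (compat_idComulId hD).map_sub_one hΦ
    obtain ⟨a4, b4⟩ := hM.compat_oneTensor₃.map_sub_one hΦ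
    obtain ⟨a5, b5⟩ := hM.compat_tensorOne₃.map_sub_one hΦ
    -- All five factors of the pentagon lie in `1 + fil n`, so the leading term of each side is the
    -- sum of the leading terms of its factors.
    have hp := congrArg (fun x => (P.tensor (P.tensor (P.tensor P))).sym n (x - 1))
      (Q.pentagon_twist J)
    rw [hM4.sym_mul_sub_one hn a1 a2, hM4.sym_mul_sub_one hn (hM4.mul_sub_one_mem a4 a3) a5,
      hM4.sym_mul_sub_one hn a4 a3, b1, b2, b3, b4, b5] at hp
    exact hp
  obtain ⟨j, hj⟩ : ∃ j : Gr k I ⊗[k] Gr k I, (P.tensor (P.tensor P)).sym n (Ψ - 1) =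
      oneTensor₂ k (Gr k I) j - comulId k h.grComul j + idComul k h.grComul j -
        tensorOne₂ k (Gr k I) j := by
    let _ := (Q.gr I h).toHopfAlgebra hgr
    have : FiniteDimensional k (Gr k I) := Gr.finiteDimensional hN
    exact exists_eq_coboundary hH _ hlin
  have c1 : Compat (P.tensor P) (P.tensor (P.tensor P)) 0 (oneTensor₂ k A)
      (oneTensor₂ k (Gr k I)) := hM.compat_one_tmul (P.tensor P)
  have c2 := compat_comulId hD
  have c3 := compat_idComul hD
  have c4 := hM.compat_tensorOne₂
  -- `j` need not be homogeneous; `s2.sec n` keeps only its degree `n` component.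
  set g := s2.sec n j
  have hg : g ∈ (P.tensor P).fil n := s2.sec_mem n j
  have hdg : (P.tensor (P.tensor P)).sym n (oneTensor₂ k A g - comulId k D g + idComul k D g -
      tensorOne₂ k A g) = (P.tensor (P.tensor P)).sym n (Ψ - 1) := by
    -- The coboundary map commutes with the sections modulo `fil (n + 1)`, so the coboundary of the
    -- lift `g` and `Ψ - 1` both agree with the lift of the leading term of `Ψ - 1`.
    have e1 := s2.sub_sec_mem s3
      (d := (oneTensor₂ k A).toLinearMap - (comulId k D).toLinearMap + (idComul k D).toLinearMap -
        (tensorOne₂ k A).toLinearMap)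
      (d₀ := (oneTensor₂ k (Gr k I)).toLinearMap - (comulId k h.grComul).toLinearMap +
        (idComul k h.grComul).toLinearMap - (tensorOne₂ k (Gr k I)).toLinearMap)
      (Compat.sub (Compat.add (Compat.sub c1 c2) c3) c4) n j
    have e2 := s3.sub_sec_sym n _ hΦ
    rw [hj] at e2
    have e3 := (P.tensor (P.tensor P)).sym_succ n _ (sub_mem e1 e2)
    simp only [LinearMap.sub_apply, LinearMap.add_apply, AlgHom.toLinearMap_apply] at e3
    rw [sub_sub_sub_cancel_right, map_sub, sub_eq_zero] at e3
    exact e3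
  -- The sign is forced: twisting by `1 + x` adds the coboundary of `x` to the leading term, which
  -- here must be cancelled.
  obtain ⟨F, hF⟩ : IsUnit (1 + -g) :=
    hM2.isUnit_one_add (tensor_eq_bot hN hN) (neg_mem ((P.tensor P).anti hn hg))
  have hFg : (F : A ⊗[k] A) - 1 = -g := by rw [hF]; abel
  have hF1 : (F : A ⊗[k] A) - 1 ∈ (P.tensor P).fil n := by rw [hFg]; exact neg_mem hg
  refine ⟨F, hF1, ?_⟩
  obtain ⟨a1, -⟩ := Compat.map_sub_one c1 hF1
  obtain ⟨a2, -⟩ := Compat.map_sub_one c2 hF1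
  obtain ⟨a3, -⟩ := Compat.map_sub_one c3 hF1
  obtain ⟨a4, -⟩ := Compat.map_sub_one c4 hF1
  have hsub : ∀ m : A ⊗[k] A →ₐ[k] A ⊗[k] (A ⊗[k] A), m F - 1 = -m g := by
    intro m
    rw [← map_one m, ← map_sub, hFg, map_neg]
  have hmul := Q.twistAssoc_mul J F
  have hX := hM3.mul_sub_one_mem a4 a2
  have hY := hM3.mul_sub_one_mem a1 a3
  -- Both sides of `twistAssoc_mul` are compared to first order before any division: the difference
  -- of their leading terms is that of `Ψ - 1` minus that of the coboundary of `g`, hence zero.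
  have hfil : (oneTensor₂ k A F * idComul k D F * Ψ - 1) - (tensorOne₂ k A F * comulId k D F - 1) ∈
      (P.tensor (P.tensor P)).fil (n + 1) := by
    refine s3.mem_fil_succ (sub_mem (hM3.mul_sub_one_mem hY hΦ) hX) ?_
    rw [map_sub, hM3.sym_mul_sub_one hn hY hΦ, hM3.sym_mul_sub_one hn a1 a3,
      hM3.sym_mul_sub_one hn a4 a2, ← hdg]
    simp only [hsub, map_sub, map_add, map_neg]
    abel
  rw [← hmul, sub_sub_sub_cancel_right] at hfil
  set X : (A ⊗[k] (A ⊗[k] A))ˣ := Units.map (tensorOne₂ k A).toMonoidHom F *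
    Units.map (comulId k D).toMonoidHom F
  have hXe : (X : A ⊗[k] (A ⊗[k] A)) = tensorOne₂ k A F * comulId k D F := rfl
  -- The difference is `(Q.twistAssoc (F * J) - 1) * X`, and `X` is invertible.
  have hfin := (hM3.mul (n + 1) 0 (n + 1) rfl _ hfil _ (hM3.mem (↑X⁻¹))).1
  rwa [← hXe, sub_mul, mul_assoc, Units.mul_inv, mul_one] at hfin

/-- Some twist of `Q` has associator `1`. -/
lemma exists_twistAssoc_eq_one (h : Q.IsQuasiHopfIdeal I) {N : ℕ} (hN : powSub k I N = ⊥)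
    (hgr : (Q.gr I h).IsHopf) (hH : Subsingleton ((Q.gr I h).DualH3 hgr)) :
    ∃ J : (A ⊗[k] A)ˣ, Q.twistAssoc J = 1 := by
  have key : ∀ n : ℕ, ∃ J : (A ⊗[k] A)ˣ,
      (J : A ⊗[k] A) - 1 ∈ ((Gr.filt k I).tensor (Gr.filt k I)).fil 1 ∧
      Q.twistAssoc J - 1 ∈
        ((Gr.filt k I).tensor ((Gr.filt k I).tensor (Gr.filt k I))).fil (n + 1) := by
    intro n
    induction n with
    | zero =>
      -- With the trivial twist, the claim is that `Φ` has degree `0` leading term `1`, which is the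
      -- hypothesis `hgr`.
      refine ⟨1, by simp, ?_⟩
      have e : Q.twistAssoc 1 = Q.assoc := by simp [twistAssoc]
      rw [e]
      let s := Gr.splitting I k
      refine (filt_isMult₃ I).sub_one_mem_of_sym_zero (s.tensor (s.tensor s)) ?_
      exact congrArg Units.val hgr
    | succ n ih =>
      obtain ⟨J, hJ, hΦ⟩ := ih
      obtain ⟨F, hF, hΦ'⟩ := exists_twistAssoc_step h hN hgr hH (Nat.le_add_left 1 n) hJ hΦ
      refine ⟨F * J, ?_, hΦ'⟩
      have hM : ((Gr.filt k I).tensor (Gr.filt k I)).IsMult :=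
        Gr.filt_isMult.tensor Gr.filt_isMult
      exact hM.mul_sub_one_mem (Filt.anti _ (Nat.le_add_left 1 n) hF) hJ
  -- Each of the three tensor factors has `fil N = 0`, so the filtration on the triple tensor
  -- product vanishes from degree `3N` on.
  obtain ⟨J, -, hJ⟩ := key (N + (N + N))
  refine ⟨J, sub_eq_zero.1 ?_⟩
  have hbot : ((Gr.filt k I).tensor ((Gr.filt k I).tensor (Gr.filt k I))).fil (N + (N + N)) = ⊥ :=
    tensor_eq_bot hN (tensor_eq_bot hN hN)
  have := Filt.fil_succ_le _ _ hJ
  rwa [hbot, Submodule.mem_bot] at this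

end QuasiHopf

/-! ### Counits applied to the coface maps. -/

section CounitIdentities

variable {k : Type*} [Field k] {A : Type*} [Ring A] [Algebra k A] (ε : A →ₐ[k] k)

@[simp] lemma counitId_tmul (x y : A) : counitId k ε (x ⊗ₜ y) = ε x • y := by
  simp [counitId]

@[simp] lemma idCounit_tmul (x y : A) : idCounit k ε (x ⊗ₜ y) = ε y • x := by
  simp [idCounit]

lemma idCounitId_oneTensor₂ (t : A ⊗[k] A) :
    idCounitId k ε (oneTensor₂ k A t) = 1 ⊗ₜ counitId k ε t := by
  simp [idCounitId, oneTensor₂]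

lemma idCounitId_tensorOne₂ (t : A ⊗[k] A) :
    idCounitId k ε (tensorOne₂ k A t) = idCounit k ε t ⊗ₜ 1 := by
  induction t with
  | zero => simp
  | add a b ha hb => simp only [map_add, ha, hb, TensorProduct.add_tmul]
  | tmul x y => simp [idCounitId, tensorOne₂, TensorProduct.smul_tmul]

end CounitIdentities

/-! ### Sandwiching elements with the antipode. -/

section SandwichIdentities

variable {k : Type*} [Field k] {A : Type*} [Ring A] [Algebra k A] {S : A →ₗ[k] A}

lemma sandL_tmul (a x y : A) : sandL k S a (x ⊗ₜ y) = S x * a * y := rfl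

lemma sandR_tmul (b x y : A) : sandR k S b (x ⊗ₜ y) = x * b * S y := rfl

lemma zigzagR_tmul (a b x y z : A) :
    zigzagR k S a b (x ⊗ₜ (y ⊗ₜ z)) = x * b * (S y * a * z) := rfl

lemma sandL_add (a b : A) (t : A ⊗[k] A) : sandL k S (a + b) t = sandL k S a t + sandL k S b t := by
  induction t with
  | zero => simp
  | add x y hx hy => simp only [map_add, hx, hy]; abel
  | tmul x y => simp only [sandL_tmul, mul_add, add_mul]

lemma sandR_add (a b : A) (t : A ⊗[k] A) : sandR k S (a + b) t = sandR k S a t + sandR k S b t := by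
  induction t with
  | zero => simp
  | add x y hx hy => simp only [map_add, hx, hy]; abel
  | tmul x y => simp only [sandR_tmul, mul_add, add_mul]

lemma sandL_smul (c : k) (a : A) (t : A ⊗[k] A) : sandL k S (c • a) t = c • sandL k S a t := by
  induction t with
  | zero => simp
  | add x y hx hy => simp only [map_add, hx, hy, smul_add]
  | tmul x y => simp only [sandL_tmul, mul_smul_comm, smul_mul_assoc]

lemma sandR_smul (c : k) (a : A) (t : A ⊗[k] A) : sandR k S (c • a) t = c • sandR k S a t := by
  induction t with
  | zero => simp
  | add x y hx hy => simp only [map_add, hx, hy, smul_add]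
  | tmul x y => simp only [sandR_tmul, mul_smul_comm, smul_mul_assoc]

/-- As `S` reverses products, `a · (x ⊗ y) = S(x) a y` is a right action of `A ⊗ A` on `A`; dually,
`sandR` below gives a left action. -/
lemma sandL_mul (hS : ∀ a b : A, S (a * b) = S b * S a) (a : A) (X Y : A ⊗[k] A) :
    sandL k S a (X * Y) = sandL k S (sandL k S a X) Y := by
  induction X with
  | zero =>
    have := sandL_smul (S := S) (0 : k) (0 : A) Y
    rw [zero_smul, zero_smul] at this
    simp [this]
  | add x y hx hy => simp only [add_mul, map_add, hx, hy, sandL_add]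
  | tmul x y =>
    induction Y with
    | zero => simp
    | add x y hx hy => simp only [mul_add, map_add, hx, hy]
    | tmul z w =>
      simp only [Algebra.TensorProduct.tmul_mul_tmul, sandL_tmul, hS, mul_assoc]

lemma sandR_mul (hS : ∀ a b : A, S (a * b) = S b * S a) (b : A) (X Y : A ⊗[k] A) :
    sandR k S b (X * Y) = sandR k S (sandR k S b Y) X := by
  induction Y with
  | zero =>
    have := sandR_smul (S := S) (0 : k) (0 : A) X
    rw [zero_smul, zero_smul] at this
    simp [this]
  | add x y hx hy => simp only [mul_add, map_add, hx, hy, sandR_add]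
  | tmul x y =>
    induction X with
    | zero => simp
    | add x y hx hy => simp only [add_mul, map_add, hx, hy]
    | tmul z w =>
      simp only [Algebra.TensorProduct.tmul_mul_tmul, sandR_tmul, hS, mul_assoc]

/-- In the middle leg `S` reverses the product of a leg of `X` and a leg of `Y`, so the expression
splits at that point into a `Y` part and an `X` part. -/
lemma zigzagR_oneTensor₂_mul_tensorOne₂ (hS : ∀ a b : A, S (a * b) = S b * S a) (a b : A)
    (X Y : A ⊗[k] A) :
    zigzagR k S a b (oneTensor₂ k A X * tensorOne₂ k A Y) = sandR k S b Y * sandL k S a X := by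
  induction Y with
  | zero => simp
  | add x y hx hy => simp only [map_add, mul_add, add_mul, hx, hy]
  | tmul x y =>
    induction X with
    | zero => simp
    | add x y hx hy => simp only [map_add, mul_add, add_mul, hx, hy]
    | tmul z w =>
      simp [oneTensor₂, tensorOne₂, zigzagR_tmul, sandR_tmul, sandL_tmul, hS, mul_assoc]

end SandwichIdentities

/-! ### From a trivial twisted associator to a Hopf algebra. -/

namespace QuasiHopf

variable {k : Type*} [Field k] {A : Type*} [Ring A] [Algebra k A] (Q : QuasiHopf k A)

/-- The two legs of `Δ(v)` end up around `α` as `S(v₁) α v₂`, which is `ε(v) α`. In the next lemma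
the legs of `Δ(u)` meet around `β` in the same way. -/
lemma zigzagR_idComul_mul (a b : A) (ha : a = Q.alpha) (t : A ⊗[k] A) (X : A ⊗[k] (A ⊗[k] A)) :
    zigzagR k Q.antipode a b (idComul k Q.comul t * X) =
      idCounit k Q.counit t * zigzagR k Q.antipode a b X := by
  subst ha
  induction t with
  | zero => simp
  | add x y hx hy => simp only [map_add, add_mul, hx, hy]
  | tmul u v =>
    induction X with
    | zero => simp
    | add x y hx hy => simp only [map_add, mul_add, hx, hy]
    | tmul x Y =>
      have h : sandL k Q.antipode Q.alpha (Q.comul v * Y) =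
          Q.counit v • sandL k Q.antipode Q.alpha Y := by
        rw [sandL_mul Q.antipode_mul, Q.antipode_left, sandL_smul]
      have hz : ∀ (x : A) (Y : A ⊗[k] A), zigzagR k Q.antipode Q.alpha b (x ⊗ₜ Y) =
        x * b * sandL k Q.antipode Q.alpha Y := fun _ _ => rfl
      simp only [idComul, Algebra.TensorProduct.map_tmul, AlgHom.id_apply,
        Algebra.TensorProduct.tmul_mul_tmul, hz, h, idCounit_tmul, mul_smul_comm, smul_mul_assoc,
        mul_assoc]

lemma zigzagR_mul_comulId (a : A) (X : A ⊗[k] (A ⊗[k] A)) (t : A ⊗[k] A) :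
    zigzagR k Q.antipode a Q.beta (X * comulId k Q.comul t) =
      zigzagR k Q.antipode a Q.beta X * counitId k Q.counit t := by
  induction t with
  | zero => simp
  | add x y hx hy => simp only [map_add, mul_add, hx, hy]
  | tmul u v =>
    induction X with
    | zero => simp
    | add x y hx hy => simp only [map_add, add_mul, hx, hy]
    | tmul x Y =>
      induction Y with
      | zero => simp
      | add x y hx hy => simp only [TensorProduct.tmul_add, map_add, add_mul, hx, hy]
      | tmul y z =>
        have h : ∀ w : A ⊗[k] A, zigzagR k Q.antipode a Q.beta ((x ⊗ₜ (y ⊗ₜ z)) *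
            TensorProduct.assoc k A A A (w ⊗ₜ v)) =
            x * sandR k Q.antipode Q.beta w * (Q.antipode y * a * (z * v)) := by
          intro w
          induction w with
          | zero => simp
          | add p q hp hq => simp only [TensorProduct.add_tmul, map_add, mul_add, add_mul, hp, hq]
          | tmul p q =>
            simp [zigzagR_tmul, sandR_tmul, Q.antipode_mul, mul_assoc]
        refine (h (Q.comul u)).trans ?_
        rw [Q.antipode_right, zigzagR_tmul, counitId_tmul]
        simp only [mul_smul_comm, smul_mul_assoc, mul_assoc]

lemma idCounitId_idComul (t : A ⊗[k] A) :
    idCounitId k Q.counit (idComul k Q.comul t) = t := by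
  induction t with
  | zero => simp
  | add x y hx hy => simp only [map_add, hx, hy]
  | tmul u v => simp [idCounitId, idComul, Q.counit_comul]

lemma idCounitId_comulId (t : A ⊗[k] A) :
    idCounitId k Q.counit (comulId k Q.comul t) = t := by
  induction t with
  | zero => simp
  | add x y hx hy => simp only [map_add, hx, hy]
  | tmul u v =>
    have h : ∀ w : A ⊗[k] A, idCounitId k Q.counit (TensorProduct.assoc k A A A (w ⊗ₜ v)) =
        idCounit k Q.counit w ⊗ₜ v := by
      intro w
      induction w with
      | zero => simp
      | add p q hp hq => simp only [TensorProduct.add_tmul, map_add, hp, hq]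
      | tmul p q => simp [idCounitId, TensorProduct.smul_tmul]
    refine (h (Q.comul u)).trans ?_
    rw [Q.comul_counit]

/-- An invertible element with trivial twisted associator can be rescaled to a twist. -/
lemma exists_isTwist {J : (A ⊗[k] A)ˣ} (hJ : Q.twistAssoc J = 1) :
    ∃ J' : (A ⊗[k] A)ˣ, Q.IsTwist J' ∧ Q.twistAssoc J' = 1 := by
  -- Apply `id ⊗ ε ⊗ id` to `Φ^J = 1`: the two inner factors become `J` and `J⁻¹` and cancel.
  have h1 : (1 : A) ⊗ₜ[k] counitId k Q.counit J = idCounit k Q.counit J ⊗ₜ 1 := by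
    have h := congrArg (idCounitId k Q.counit) hJ
    simp only [twistAssoc, map_mul, idCounitId_oneTensor₂, idCounitId_tensorOne₂,
      idCounitId_idComul, idCounitId_comulId, Q.counit_assoc, mul_one, map_one] at h
    rw [mul_assoc _ (J : A ⊗[k] A), Units.mul_inv, mul_one] at h
    have h' := congrArg (· * (idCounit k Q.counit J ⊗ₜ[k] (1 : A))) h
    simp only [mul_assoc, one_mul] at h'
    rwa [Algebra.TensorProduct.tmul_mul_tmul (idCounit k Q.counit ↑J⁻¹), ← map_mul,
      Units.inv_mul, map_one, one_mul, ← Algebra.TensorProduct.one_def, mul_one] at h'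
  -- An element that is both `1 ⊗ x` and `y ⊗ 1` is a scalar; applying `ε` to either leg shows that
  -- `x` and `y` are the same scalar `c`.
  set c := Q.counit (counitId k Q.counit J) with hc
  have hb : idCounit k Q.counit J = c • 1 := by
    have := congrArg (idCounit k Q.counit) h1
    simpa using this.symm
  have ha : counitId k Q.counit J = c • 1 := by
    have := congrArg (counitId k Q.counit) h1
    simp only [counitId_tmul, map_one, one_smul] at this
    rw [this, hb]
    simp
  have hc0 : c ≠ 0 := by
    have : c * Q.counit (counitId k Q.counit ↑J⁻¹) = 1 := by
      rw [hc, ← map_mul, ← map_mul, Units.mul_inv, map_one, map_one]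
    exact left_ne_zero_of_mul_eq_one this
  let F : (A ⊗[k] A)ˣ := Units.map (algebraMap k (A ⊗[k] A)).toMonoidHom (Units.mk0 c hc0)⁻¹
  have hF : (F : A ⊗[k] A) = algebraMap k (A ⊗[k] A) c⁻¹ := by simp [F]
  refine ⟨F * J, ⟨?_, ?_⟩, ?_⟩
  · rw [Units.val_mul, map_mul, hF, AlgHom.commutes, ha, Algebra.algebraMap_eq_smul_one,
      smul_mul_smul_comm, inv_mul_cancel₀ hc0, one_smul, one_mul]
  · rw [Units.val_mul, map_mul, hF, AlgHom.commutes, hb, Algebra.algebraMap_eq_smul_one,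
      smul_mul_smul_comm, inv_mul_cancel₀ hc0, one_smul, one_mul]
  -- For the scalar `F = c⁻¹` both sides of the composition formula carry the same invertible factor
  -- `c⁻²`, which cancels.
  · have h := Q.twistAssoc_mul J F
    rw [hJ, mul_one, hF] at h
    simp only [AlgHom.commutes] at h
    rw [← map_mul] at h
    have hu : IsUnit (algebraMap k (A ⊗[k] (A ⊗[k] A)) (c⁻¹ * c⁻¹)) :=
      (IsUnit.mk0 _ (mul_ne_zero (inv_ne_zero hc0) (inv_ne_zero hc0))).map _
    exact hu.mul_eq_right.1 h

variable {Q}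

lemma IsTwist.counitId_inv {J : (A ⊗[k] A)ˣ} (hJ : Q.IsTwist J) :
    counitId k Q.counit (↑J⁻¹ : A ⊗[k] A) = 1 := by
  have h := map_mul (counitId k Q.counit) (J : A ⊗[k] A) ↑J⁻¹
  rwa [Units.mul_inv, map_one, hJ.1, one_mul, eq_comm] at h

lemma IsTwist.idCounit_inv {J : (A ⊗[k] A)ˣ} (hJ : Q.IsTwist J) :
    idCounit k Q.counit (↑J⁻¹ : A ⊗[k] A) = 1 := by
  have h := map_mul (idCounit k Q.counit) (J : A ⊗[k] A) ↑J⁻¹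
  rwa [Units.mul_inv, map_one, hJ.2, one_mul, eq_comm] at h

/-- Clearing inverses from `Φ^J = 1` exhibits `Φ` as a multiplicative coboundary of `J`; this form
serves both coassociativity and the zigzag computation. -/
lemma idComul_mul_eq_of_twistAssoc {J : (A ⊗[k] A)ˣ} (hΦ : Q.twistAssoc J = 1) :
    oneTensor₂ k A J * idComul k Q.comul J * Q.assoc =
      tensorOne₂ k A J * comulId k Q.comul J := by
  have h := congrArg (· * (tensorOne₂ k A J * comulId k Q.comul J)) hΦ
  simp only [twistAssoc, one_mul] at h
  rw [← h]
  have e1 : tensorOne₂ k A ↑J⁻¹ * tensorOne₂ k A J = 1 := by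
    rw [← map_mul, Units.inv_mul, map_one]
  have e2 : comulId k Q.comul ↑J⁻¹ * comulId k Q.comul J = 1 := by
    rw [← map_mul, Units.inv_mul, map_one]
  rw [mul_assoc _ (tensorOne₂ k A ↑J⁻¹), ← mul_assoc (tensorOne₂ k A ↑J⁻¹), e1, one_mul,
    mul_assoc _ (comulId k Q.comul ↑J⁻¹), e2, mul_one]

/-- If the twisted associator is `1`, then the twisted coproduct is coassociative. -/
lemma coassoc_of_twistAssoc {J : (A ⊗[k] A)ˣ} (hΦ : Q.twistAssoc J = 1) (a : A) :
    idComul k (Q.twistComulHom J) (Q.twistComulHom J a) =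
      comulId k (Q.twistComulHom J) (Q.twistComulHom J a) := by
  have h := idComul_mul_eq_of_twistAssoc hΦ
  -- The two iterated twisted coproducts are the untwisted ones conjugated by `U` and `U'`, and `U =
  -- U' Φ` absorbs the conjugation by `Φ` in quasi-coassociativity.
  set U : (A ⊗[k] (A ⊗[k] A))ˣ := Units.map (tensorOne₂ k A).toMonoidHom J *
    Units.map (comulId k Q.comul).toMonoidHom J with hU
  set U' : (A ⊗[k] (A ⊗[k] A))ˣ := Units.map (oneTensor₂ k A).toMonoidHom J *
    Units.map (idComul k Q.comul).toMonoidHom J with hU'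
  have hUU : U = U' * Q.assoc := Units.ext h.symm
  have e1 : idComul k (Q.twistComulHom J) (Q.twistComulHom J a) =
      U' * idComul k Q.comul (Q.comul a) * ↑U'⁻¹ := by
    rw [idComul_twist, twistComulHom_apply, map_mul, map_mul, hU', mul_inv_rev, Units.val_mul,
      Units.val_mul]
    simp only [mul_assoc]
    rfl
  have e2 : comulId k (Q.twistComulHom J) (Q.twistComulHom J a) =
      U * comulId k Q.comul (Q.comul a) * ↑U⁻¹ := by
    rw [comulId_twist, twistComulHom_apply, map_mul, map_mul, hU, mul_inv_rev, Units.val_mul,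
      Units.val_mul]
    simp only [mul_assoc]
    rfl
  rw [e1, e2, Q.quasi_coassoc]
  clear_value U U'
  subst hUU
  rw [mul_inv_rev, Units.val_mul, Units.val_mul]
  simp only [mul_assoc]

/-- Write `Φ = (id ⊗ Δ)(J⁻¹) (1 ⊗ J⁻¹) (J ⊗ 1) (Δ ⊗ id)(J)` in the zigzag axiom. The antipode axioms
turn the outer factors into counits of `J⁻¹` and `J`, which are `1` for a twist; the inner factors
give `β^J α^J`. -/
lemma twistBeta_mul_twistAlpha {J : (A ⊗[k] A)ˣ} (hJ : Q.IsTwist J) (hΦ : Q.twistAssoc J = 1) :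
    Q.twistBeta J * Q.twistAlpha J = 1 := by
  have h : (Q.assoc : A ⊗[k] (A ⊗[k] A)) = idComul k Q.comul ↑J⁻¹ *
      (oneTensor₂ k A ↑J⁻¹ * tensorOne₂ k A J * comulId k Q.comul J) := by
    rw [mul_assoc (oneTensor₂ k A ↑J⁻¹), ← idComul_mul_eq_of_twistAssoc hΦ]
    have e1 : oneTensor₂ k A ↑J⁻¹ * oneTensor₂ k A J = 1 := by
      rw [← map_mul, Units.inv_mul, map_one]
    have e2 : idComul k Q.comul ↑J⁻¹ * idComul k Q.comul J = 1 := by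
      rw [← map_mul, Units.inv_mul, map_one]
    rw [← mul_assoc, ← mul_assoc, ← mul_assoc, mul_assoc _ (oneTensor₂ k A ↑J⁻¹), e1, mul_one, e2,
      one_mul]
  have h1 := Q.zigzag_assoc
  rwa [h, Q.zigzagR_idComul_mul _ _ rfl, Q.zigzagR_mul_comulId, hJ.idCounit_inv, hJ.1, one_mul,
    mul_one, zigzagR_oneTensor₂_mul_tensorOne₂ Q.antipode_mul] at h1

/-- A twist of a quasi-Hopf algebra, if its associator is `1`. -/
def twist [FiniteDimensional k A] {J : (A ⊗[k] A)ˣ} (hJ : Q.IsTwist J)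
    (hΦ : Q.twistAssoc J = 1) : QuasiHopf k A where
  comul := Q.twistComulHom J
  counit := Q.counit
  assoc := 1
  antipode := Q.antipode
  alpha := Q.twistAlpha J
  beta := Q.twistBeta J
  quasi_coassoc a := by
    rw [Units.val_one, inv_one, Units.val_one, one_mul, mul_one]
    exact coassoc_of_twistAssoc hΦ a
  pentagon := by
    rw [Units.val_one]
    simp only [map_one, mul_one]
  counit_comul a := by
    rw [twistComulHom_apply, map_mul, map_mul, hJ.1, hJ.counitId_inv, Q.counit_comul, one_mul,
      mul_one]
  comul_counit a := by
    rw [twistComulHom_apply, map_mul, map_mul, hJ.2, hJ.idCounit_inv, Q.comul_counit, one_mul,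
      mul_one]
  counit_assoc := by simp only [Units.val_one, map_one]
  antipode_one := Q.antipode_one
  antipode_mul := Q.antipode_mul
  antipode_bijective := Q.antipode_bijective
  antipode_left a := by
    rw [twistAlpha, ← sandL_mul Q.antipode_mul, twistComulHom_apply, mul_assoc, ← mul_assoc,
      Units.inv_mul, one_mul, sandL_mul Q.antipode_mul, Q.antipode_left, sandL_smul]
  antipode_right a := by
    rw [twistBeta, ← sandR_mul Q.antipode_mul, twistComulHom_apply, mul_assoc, Units.inv_mul,
      mul_one, sandR_mul Q.antipode_mul, Q.antipode_right, sandR_smul]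
  zigzag_assoc := by
    rw [Units.val_one, Algebra.TensorProduct.one_def, Algebra.TensorProduct.one_def, zigzagR_tmul,
      Q.antipode_one, one_mul, mul_one, one_mul]
    exact twistBeta_mul_twistAlpha hJ hΦ
  zigzag_assoc_inv := by
    -- This axiom asks for `α^J β^J = 1`, the opposite order; in a finite dimensional algebra a
    -- one-sided inverse is two-sided.
    have : IsArtinianRing A := IsArtinianRing.of_finite k A
    have h := mul_eq_one_comm.1 (twistBeta_mul_twistAlpha hJ hΦ)
    rw [inv_one, Units.val_one, Algebra.TensorProduct.one_def, Algebra.TensorProduct.one_def]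
    change Q.antipode 1 * Q.twistAlpha J * (1 * Q.twistBeta J * Q.antipode 1) = 1
    rw [Q.antipode_one, one_mul, mul_one, one_mul]
    exact h

/-- A quasi-Hopf algebra with a twist of associator `1` is twist equivalent to a Hopf algebra. -/
lemma exists_twistEquivalent {k : Type*} [Field k] {A : Type u} [Ring A] [Algebra k A]
    [FiniteDimensional k A] {Q : QuasiHopf k A} {J : (A ⊗[k] A)ˣ} (hJ : Q.IsTwist J)
    (hΦ : Q.twistAssoc J = 1) :
    ∃ (H : Type u) (_ : Ring H) (_ : HopfAlgebra k H)
      (hS : Function.Bijective (HopfAlgebra.antipode k (A := H))),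
      Q.TwistEquivalent (ofHopf k H hS) := by
  have : IsArtinianRing A := IsArtinianRing.of_finite k A
  have h1 := twistBeta_mul_twistAlpha hJ hΦ
  have h2 : Q.twistAlpha J * Q.twistBeta J = 1 := mul_eq_one_comm.1 h1
  -- Taking `u = β^J`, with inverse `α^J`, gives `u α^J = 1 = β^J u⁻¹`, and `u S(·) u⁻¹` is the
  -- antipode of `toHopfAlgebra`.
  let w : Aˣ := ⟨Q.twistBeta J, Q.twistAlpha J, h1, h2⟩
  have hanti : ∀ a, ((twist hJ hΦ).toHopfAlgebra rfl).antipode a =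
      w * Q.antipode a * ↑w⁻¹ := fun a => (mul_assoc _ _ _).symm
  refine ⟨A, inferInstance, (twist hJ hΦ).toHopfAlgebra rfl, ?_, J, AlgEquiv.refl, w, hJ, ?_, ?_,
    ?_, ?_, ?_, ?_⟩
  · have hw : Function.Bijective fun a : A => (w : A) * a * ↑w⁻¹ := by
      refine Function.bijective_iff_has_inverse.2 ⟨fun a => ↑w⁻¹ * a * w, fun a => ?_, fun a => ?_⟩
      · simp [mul_assoc]
      · simp [mul_assoc]
    rw [show ⇑((twist hJ hΦ).toHopfAlgebra rfl).antipode = _ from funext hanti]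
    exact hw.comp Q.antipode_bijective
  · intro a
    have hmap : Algebra.TensorProduct.map (AlgHom.id k A) (AlgHom.id k A) =
        AlgHom.id k (A ⊗[k] A) := Algebra.TensorProduct.map_id
    exact (AlgHom.congr_fun hmap (Q.twistComul J a)).symm
  · intro a
    rfl
  · rw [hΦ, map_one]
    rfl
  · intro a
    exact hanti a
  · exact h1.symm
  · exact h1.symm

end QuasiHopf

end QH

end

theorem proposition2p5 {A : Type u} [Ring A] [Algebra ℂ A] [FiniteDimensional ℂ A]
    (Q : QH.QuasiHopf ℂ A)
    (hrad : Q.IsQuasiHopfIdeal (Ring.jacobson A))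
    (hgr : (Q.gr (Ring.jacobson A) hrad).IsHopf)
    (hH3 : Subsingleton ((Q.gr (Ring.jacobson A) hrad).DualH3 hgr)) :
    ∃ (H : Type u) (_ : Ring H) (_ : HopfAlgebra ℂ H)
      (hS : Function.Bijective (HopfAlgebra.antipode ℂ (A := H))),
      Q.TwistEquivalent (QH.QuasiHopf.ofHopf ℂ H hS) := by
  -- Finite dimensionality makes `A` Artinian, hence semiprimary, so its radical is nilpotent.
  have : IsArtinianRing A := IsArtinianRing.of_finite ℂ A
  obtain ⟨N, hN⟩ := IsSemiprimaryRing.isNilpotent (R := A)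
  have hN' : QH.powSub ℂ (Ring.jacobson A) N = ⊥ := by
    ext x
    change x ∈ Ring.jacobson A ^ N ↔ _
    rw [hN]
    rfl
  obtain ⟨J, hJ⟩ := QH.QuasiHopf.exists_twistAssoc_eq_one hrad hN' hgr hH3
  obtain ⟨J', hJ', hΦ⟩ := Q.exists_isTwist hJ
  exact QH.QuasiHopf.exists_twistEquivalent hJ' hΦ
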